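/- Fix integers $n,m$. Let $\operatorname{Sym}^2(\mathbb R^k)$ be the space of symmetric $k\times k$ matrices and $\mathcal P=\mathcal P_k$ the positive semidefinite ones. A *Dirichlet set* is a non-empty, proper, closed $F\subset \operatorname{Sym}^2(\mathbb R^n)$ with $F+\mathcal P\subset F$. Its *Dirichlet dual* is $\tilde F=\{A: -A\notin \operatorname{Int}F\}$. Its *ray set* $\overrightarrow F$ is the closure of $\{A:\exists \lambda_0\ \forall \lambda\ge\lambda_0,\ B+\lambda A\in F\}$, which does not depend on $B\in\operatorname{Sym}^2(\mathbb R^n)$. For an open set $X\subset\mathbb R^k$ and a closed set $G\subset\operatorname{Sym}^2(\mathbb R^k)$, an upper-semicontinuous $f:X\to\mathbb R\cup\{-\infty\}$ is *$G$-subharmonic* if $\operatorname{Hess}_{x_0}(g)\in G$ whenever $x_0\in X$ and $g$ is a smooth function near $x_0$ with $g\ge f$ near $x_0$ and $g(x_0)=f(x_0)$. The set $F\star\mathcal P\subset\operatorname{Sym}^2(\mathbb R^{n+m})$ consists of the matrices $A=\begin{pmatrix}B&C\\ C^T&D\end{pmatrix}$ ($B$ of size $n\times n$, $D$ of size $m\times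 m$) such that $D\in\mathcal P_m$ and $B+C\Gamma+\Gamma^TC^T+\Gamma^TD\Gamma\in F$ for every real $m\times n$ matrix $\Gamma$. Let $\Omega\subset\mathbb R^n$ be open and bounded with smooth boundary. It is *strictly $\overrightarrow F$-convex* if at each $\tau\in\partial\Omega$, for a smooth local defining function $\rho$ of $\partial\Omega$ near $\tau$ (so that $\Omega=\{\rho<0\}$ near $\tau$ and $\nabla\rho\ne0$), one has $\operatorname{Hess}_\tau\rho|_{T_\tau\partial\Omega}=B|_{T_\tau\partial\Omega}$ for some $B\in\operatorname{Int}(\overrightarrow F)$. **Proposition.** Let $F\subset\operatorname{Sym}^2(\mathbb R^n)$ be a convex Dirichlet set, and let $\Omega\subset\mathbb R^n$ be open and bounded with smooth boundary, strictly $\overrightarrow F$-convex and strictly $\overrightarrow{\tilde F}$-convex. Let $\phi:\partial\Omega\times\mathbb R^m\to\mathbb R$ be continuous with $\phi_\tau=\phi(\tau,\cdot)$ convex for every $\tau\in\partial\Omega$, and let $\phi_\tau^*(u)=\sup_{y\in\mathbb R^m}\{y\cdot u-\phi_\tau(y)\}\in(-\infty,\infty]$ be the Legendre transforms. Assume that $\{\phi_\tau^*\}_{\tau\in\partial\Omega}$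 is locally comparable, that is: 1. for each $u\in\mathbb R^m$, either $\phi^*_\tau(u)=\infty$ for all $\tau\in\partial\Omega$, or all $\phi^*_\tau(u)$ are finite and there is a constant $C$ (which may depend on $u$) with $|\phi^*_\tau(u)-\phi^*_{\tau'}(u)|\le C$ for all $\tau,\tau'\in\partial\Omega$; 2. for each $\tau\in\partial\Omega$ the set $\{u:\phi_\tau^*(u)<\infty\}$ is open in $\mathbb R^m$. Let $\Phi$ be the pointwise supremum of all upper-semicontinuous functions $\zeta:\overline\Omega\times\mathbb R^m\to\mathbb R\cup\{-\infty\}$ such that $\zeta$ is $F\star\mathcal P$-subharmonic on $\Omega\times\mathbb R^m$ and $\zeta\le\phi$ on $\partial\Omega\times\mathbb R^m$. Then $\Phi$ is $F\star\mathcal P$-subharmonic on $\Omega\times\mathbb R^m$ (in particular upper semicontinuous and $<\infty$ there), and $\Phi=\phi$ on $\partial\Omega\times\mathbb R^m$. -/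

import Mathlib

open Set Filter Topology
open scoped ContDiff

/-- `Sym²(ℝ^ι)`: the real vector space of symmetric `ι × ι` matrices, with its subspace topology. -/
def SymMat (ι : Type*) : Submodule ℝ (Matrix ι ι ℝ) where
  carrier := {A | A.IsSymm}
  zero_mem' := Matrix.isSymm_zero
  add_mem' := fun hA hB => hA.add hB
  smul_mem' := fun c _ hA => hA.smul c

/-- The cone `𝒫` of positive semidefinite symmetric matrices. -/
def posCone (ι : Type*) : Set (SymMat ι) :=
  {A | (A : Matrix ι ι ℝ).PosSemidef}

/-- Dirichlet sets: non-empty, proper, closed subsets `F` of `Sym²` with `F + 𝒫 ⊆ F`. -/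
structure IsDirichletSet {ι : Type*} (F : Set (SymMat ι)) : Prop where
  nonempty : F.Nonempty
  ne_univ : F ≠ univ
  isClosed : IsClosed F
  add_mem : ∀ A ∈ F, ∀ P ∈ posCone ι, A + P ∈ F

/-- The Dirichlet dual `F̃ = ∼(-Int F)`; the interior is taken in `Sym²`. -/
def dirichletDual {ι : Type*} (F : Set (SymMat ι)) : Set (SymMat ι) :=
  {A | -A ∉ interior F}

/-- The ray set with vertex `B` associated to `F`. -/
def raySetAt {ι : Type*} (F : Set (SymMat ι)) (B : SymMat ι) : Set (SymMat ι) :=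
  {A | ∃ l₀ : ℝ, ∀ l : ℝ, l₀ ≤ l → B + l • A ∈ F}

/-- The ray set of `F`: the closure of the ray set with vertex `0`. Any other vertex gives the
same closure, see `closure_raySetAt`. -/
def raySet {ι : Type*} (F : Set (SymMat ι)) : Set (SymMat ι) :=
  closure (raySetAt F 0)

/-- The identity matrix as an element of `Sym²`. -/
def symOne (ι : Type*) [DecidableEq ι] : SymMat ι := ⟨1, Matrix.isSymm_one⟩

theorem exists_add_smul_symOne_mem_posCone {ι : Type*} [Fintype ι] [DecidableEq ι]
    (S : SymMat ι) : ∃ c : ℝ, ∀ t : ℝ, c ≤ t → S + t • symOne ι ∈ posCone ι := by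
  refine ⟨∑ i, ∑ j, |S.1 i j|, fun t ht => ?_⟩
  refine Matrix.PosSemidef.of_dotProduct_mulVec_nonneg ?_ fun x => ?_
  · have h := (S + t • symOne ι).2
    exact h
  · have hx : ∀ i, x i ^ 2 ≤ x ⬝ᵥ x := fun i => by
      have h := Finset.single_le_sum (f := fun k => x k * x k)
        (fun k _ => mul_self_nonneg (x k)) (Finset.mem_univ i)
      simpa [dotProduct, sq] using h
    have h0 : 0 ≤ x ⬝ᵥ x := Finset.sum_nonneg fun k _ => mul_self_nonneg (x k)
    have h1 : -((∑ i, ∑ j, |S.1 i j|) * (x ⬝ᵥ x)) ≤ x ⬝ᵥ (S.1.mulVec x) := by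
      obtain ⟨q, hq⟩ : ∃ q, q = x ⬝ᵥ x := ⟨_, rfl⟩
      rw [← hq] at hx ⊢
      simp only [dotProduct, Matrix.mulVec, Finset.sum_mul, Finset.mul_sum,
        ← Finset.sum_neg_distrib]
      refine Finset.sum_le_sum fun i _ => Finset.sum_le_sum fun j _ => ?_
      have hij : |x i * x j| ≤ q := by
        rw [abs_le]
        constructor <;> nlinarith [hx i, hx j, sq_nonneg (x i + x j), sq_nonneg (x i - x j)]
      have h2 : |S.1 i j * (x i * x j)| ≤ |S.1 i j| * q := by
        rw [abs_mul]
        exact mul_le_mul_of_nonneg_left hij (abs_nonneg _)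
      have h3 := neg_abs_le (S.1 i j * (x i * x j))
      have h4 : x i * (S.1 i j * x j) = S.1 i j * (x i * x j) := by ring
      rw [h4]
      linarith
    have h5 : x ⬝ᵥ ((S + t • symOne ι : SymMat ι).1.mulVec x)
        = x ⬝ᵥ (S.1.mulVec x) + t * (x ⬝ᵥ x) := by
      simp [symOne, Matrix.add_mulVec, Matrix.smul_mulVec, dotProduct_add, dotProduct_smul]
    have h6 := mul_le_mul_of_nonneg_right ht h0
    simp only [star_trivial]
    rw [h5]
    linarith

/-- The closure of the ray set does not depend on the vertex. -/
theorem closure_raySetAt {ι : Type*} [Fintype ι] [DecidableEq ι] {F : Set (SymMat ι)}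
    (hF : IsDirichletSet F) (B : SymMat ι) : closure (raySetAt F B) = raySet F := by
  have key : ∀ B B' : SymMat ι, raySetAt F B ⊆ closure (raySetAt F B') := by
    rintro B B' A ⟨l₀, hl₀⟩
    obtain ⟨c, hc⟩ := exists_add_smul_symOne_mem_posCone (B' - B)
    have hlim : Tendsto (fun e : ℝ => A + e • symOne ι) (𝓝[>] 0) (𝓝 A) := by
      have h : Continuous fun e : ℝ => A + e • symOne ι := by fun_prop
      have h' := (h.tendsto 0).mono_left (nhdsWithin_le_nhds (s := Ioi (0 : ℝ)))
      simpa using h'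
    refine mem_closure_of_tendsto hlim ?_
    filter_upwards [self_mem_nhdsWithin] with e he
    have he' : 0 < e := he
    refine ⟨max l₀ (c / e), fun l hl => ?_⟩
    have h1 : c ≤ l * e := by
      have := (le_max_right _ _).trans hl
      rwa [div_le_iff₀ he'] at this
    have h2 := hF.add_mem _ (hl₀ l ((le_max_left _ _).trans hl)) _ (hc _ h1)
    have h3 : B' + l • (A + e • symOne ι) = B + l • A + (B' - B + (l * e) • symOne ι) := by
      rw [smul_add, smul_smul]; abel
    rw [h3]
    exact h2
  exact Subset.antisymm (closure_minimal (key B 0) isClosed_closure)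
    (closure_minimal (key 0 B) isClosed_closure)

/-- For a symmetric matrix in block form `(B, C; Cᵀ, D)`, the block `π(A) = D`. -/
def blockPi {ι κ : Type*} (A : SymMat (ι ⊕ κ)) : SymMat κ :=
  ⟨A.1.toBlocks₂₂, by
    have h : A.1.IsSymm := A.2
    exact Matrix.IsSymm.ext fun i j => h.apply (Sum.inr i) (Sum.inr j)⟩

/-- `i_Γ^* A = (I, Γ)ᵀ A (I, Γ)`, where `(I, Γ)` is the matrix of `x ↦ (x, Γ x)`. -/
def graphPullback {ι κ : Type*} [Fintype ι] [Fintype κ] [DecidableEq ι]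
    (Γ : Matrix κ ι ℝ) (A : SymMat (ι ⊕ κ)) : SymMat ι :=
  ⟨(Matrix.fromRows (1 : Matrix ι ι ℝ) Γ).transpose * (A : Matrix (ι ⊕ κ) (ι ⊕ κ) ℝ) *
      Matrix.fromRows (1 : Matrix ι ι ℝ) Γ, by
    have h : A.1.transpose = A.1 := A.2
    change Matrix.transpose _ = _
    rw [Matrix.transpose_mul, Matrix.transpose_mul, Matrix.transpose_transpose, h,
      Matrix.mul_assoc]⟩

/-- The product `F ⋆ G` of sets of symmetric matrices. -/
def starProd {ι κ : Type*} [Fintype ι] [Fintype κ] [DecidableEq ι]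
    (F : Set (SymMat ι)) (G : Set (SymMat κ)) : Set (SymMat (ι ⊕ κ)) :=
  {A | blockPi A ∈ G ∧ ∀ Γ : Matrix κ ι ℝ, graphPullback Γ A ∈ F}

/-- The Hessian matrix of `g` at `x` in the coordinates given by the basis `b`. -/
noncomputable def hessMatrix {ι V : Type*} [NormedAddCommGroup V] [NormedSpace ℝ V]
    (b : Module.Basis ι ℝ V) (g : V → ℝ) (x : V) : Matrix ι ι ℝ :=
  Matrix.of fun i j => fderiv ℝ (fderiv ℝ g) x (b i) (b j)

/-- `g` is a test function for `f` at the point `x₀` of the open set `X`: it is smooth on an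
open neighbourhood `U` of `x₀` in `X`, `g ≥ f` on `U`, and `g x₀ = f x₀`. -/
def IsTestFunctionAt {V : Type*} [NormedAddCommGroup V] [NormedSpace ℝ V]
    (X : Set V) (f : V → EReal) (x₀ : V) (g : V → ℝ) : Prop :=
  ∃ U : Set V, IsOpen U ∧ x₀ ∈ U ∧ U ⊆ X ∧ ContDiffOn ℝ ∞ g U ∧
    (∀ x ∈ U, f x ≤ (g x : EReal)) ∧ f x₀ = (g x₀ : EReal)

/-- `F`-subharmonicity on the open set `X` of an upper semicontinuous `f : X → ℝ ∪ {-∞}`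
(only the values of `f` on `X` matter). Symmetric matrices are Hessians with respect to the
coordinates given by the basis `b`. -/
structure IsFSubharmonicOn {ι V : Type*} [NormedAddCommGroup V] [NormedSpace ℝ V]
    (b : Module.Basis ι ℝ V) (F : Set (SymMat ι)) (X : Set V) (f : V → EReal) : Prop where
  usc : UpperSemicontinuousOn f X
  ne_top : ∀ x ∈ X, f x ≠ ⊤
  hess_mem : ∀ x₀ ∈ X, ∀ g : V → ℝ, IsTestFunctionAt X f x₀ g →
    ∃ A ∈ F, (A : Matrix ι ι ℝ) = hessMatrix b g x₀

/-- The standard basis of `ℝⁿ`. -/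
noncomputable def stdBasis (n : ℕ) : Module.Basis (Fin n) ℝ (EuclideanSpace ℝ (Fin n)) :=
  (EuclideanSpace.basisFun (Fin n) ℝ).toBasis

/-- The standard basis of `ℝⁿ⁺ᵐ = ℝⁿ × ℝᵐ`. -/
noncomputable def stdBasisProd (n m : ℕ) :
    Module.Basis (Fin n ⊕ Fin m) ℝ (EuclideanSpace ℝ (Fin n) × EuclideanSpace ℝ (Fin m)) :=
  (stdBasis n).prod (stdBasis m)

/-- `ρ` is a local defining function, on the open set `U`, for the boundary of `Ω` near `τ`. -/
structure IsLocalDefiningFunction {n : ℕ} (Ω : Set (EuclideanSpace ℝ (Fin n)))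
    (τ : EuclideanSpace ℝ (Fin n)) (U : Set (EuclideanSpace ℝ (Fin n)))
    (ρ : EuclideanSpace ℝ (Fin n) → ℝ) : Prop where
  isOpen : IsOpen U
  mem : τ ∈ U
  smooth : ContDiffOn ℝ ∞ ρ U
  neg_iff : ∀ x ∈ U, x ∈ Ω ↔ ρ x < 0
  grad_ne : ∀ x ∈ U, fderiv ℝ ρ x ≠ 0

/-- `Ω` is bounded and open with smooth boundary. -/
structure IsSmoothlyBounded {n : ℕ} (Ω : Set (EuclideanSpace ℝ (Fin n))) : Prop where
  isOpen : IsOpen Ω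
  isBounded : Bornology.IsBounded Ω
  smooth : ∀ τ ∈ frontier Ω, ∃ U ρ, IsLocalDefiningFunction Ω τ U ρ

/-- Strict convexity of `Ω` with respect to the ray set of `F`: at every boundary point `τ` there
is a local defining function `ρ` such that `Hess_τ ρ` agrees on the tangent space
`T_τ ∂Ω = ker (dρ_τ)` with some `B` in the interior of the ray set. (The interior of the ray set
is a cone, so the condition does not depend on the choice of `ρ`.) -/
def IsStrictlyRayConvex {n : ℕ} (F : Set (SymMat (Fin n)))
    (Ω : Set (EuclideanSpace ℝ (Fin n))) : Prop :=
  ∀ τ ∈ frontier Ω, ∃ U ρ, IsLocalDefiningFunction Ω τ U ρ ∧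
    ∃ B ∈ interior (raySet F), ∀ v w : EuclideanSpace ℝ (Fin n),
      fderiv ℝ ρ τ v = 0 → fderiv ℝ ρ τ w = 0 →
        fderiv ℝ (fderiv ℝ ρ) τ v w = v.ofLp ⬝ᵥ ((B : Matrix (Fin n) (Fin n) ℝ).mulVec w.ofLp)

/-- The Legendre transform `η*(u) = sup_y (y · u - η y)`, with values in `(-∞, ∞]`. -/
noncomputable def legendre {m : ℕ} (η : EuclideanSpace ℝ (Fin m) → ℝ)
    (u : EuclideanSpace ℝ (Fin m)) : EReal :=
  ⨆ y : EuclideanSpace ℝ (Fin m), ((inner ℝ y u - η y : ℝ) : EReal)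

/-- The Legendre transforms of the family `φ (τ, ·)`, `τ ∈ T`, are locally comparable. The bound
in `bdd`, required for all pairs of points, says that at each `u` the transforms are either all
infinite or all finite with differences bounded in absolute value by `C`. -/
structure LocallyComparable {n m : ℕ} (T : Set (EuclideanSpace ℝ (Fin n)))
    (φ : EuclideanSpace ℝ (Fin n) × EuclideanSpace ℝ (Fin m) → ℝ) : Prop where
  bdd : ∀ u : EuclideanSpace ℝ (Fin m), ∃ C : ℝ, ∀ τ ∈ T, ∀ τ' ∈ T,
    legendre (fun y => φ (τ, y)) u ≤ legendre (fun y => φ (τ', y)) u + (C : EReal)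
  isOpen : ∀ τ ∈ T, IsOpen {u : EuclideanSpace ℝ (Fin m) | legendre (fun y => φ (τ, y)) u < ⊤}

/-- The competitors for the envelope: upper semicontinuous functions
`closure Ω × ℝᵐ → ℝ ∪ {-∞}` that are `F ⋆ 𝒫`-subharmonic on `Ω × ℝᵐ` and at most `φ` on
`∂Ω × ℝᵐ` (only the values on `closure Ω × ℝᵐ` matter). -/
structure IsPerronCompetitor {n m : ℕ} (F : Set (SymMat (Fin n)))
    (Ω : Set (EuclideanSpace ℝ (Fin n)))
    (φ : EuclideanSpace ℝ (Fin n) × EuclideanSpace ℝ (Fin m) → ℝ)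
    (ζ : EuclideanSpace ℝ (Fin n) × EuclideanSpace ℝ (Fin m) → EReal) : Prop where
  usc : UpperSemicontinuousOn ζ (closure Ω ×ˢ univ)
  ne_top : ∀ z ∈ closure Ω ×ˢ (univ : Set (EuclideanSpace ℝ (Fin m))), ζ z ≠ ⊤
  subharmonic : IsFSubharmonicOn (stdBasisProd n m) (starProd F (posCone (Fin m)))
    (Ω ×ˢ univ) ζ
  le_bdry : ∀ z ∈ frontier Ω ×ˢ (univ : Set (EuclideanSpace ℝ (Fin m))), ζ z ≤ (φ z : EReal)

/-- The Perron envelope: the pointwise supremum of all competitors. -/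
noncomputable def perronEnvelope {n m : ℕ} (F : Set (SymMat (Fin n)))
    (Ω : Set (EuclideanSpace ℝ (Fin n)))
    (φ : EuclideanSpace ℝ (Fin n) × EuclideanSpace ℝ (Fin m) → ℝ)
    (z : EuclideanSpace ℝ (Fin n) × EuclideanSpace ℝ (Fin m)) : EReal :=
  ⨆ (ζ : EuclideanSpace ℝ (Fin n) × EuclideanSpace ℝ (Fin m) → EReal)
    (_ : IsPerronCompetitor F Ω φ ζ), ζ z

/-! The upper semicontinuous regularization of the envelope is subharmonic. Smooth upper barriers,
built from strict convexity of `Ω` for the dual of `F` and applied to horizontal slices, bound it by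
`φ` on the boundary, so that it is itself a competitor. Lower barriers `y · u + h(x)`, glued from a
local barrier and a global quadratic, show that the envelope attains the boundary values; local
comparability makes an affine minorant of `φ_τ` almost a minorant at all nearby boundary points.
The convexity of `F` plays no role in this argument. -/

/-! ### Quadratic forms of symmetric matrices -/

/-! Perron's method reduces the claim to estimates at the boundary. By a maximum principle the
regularization of the envelope on `closure Ω × ℝᵐ` is subharmonic (`isFSubharmonicOn_uscReg`). If it
is also at most `φ` on the boundary, it is a competitor, hence equal to the envelope.

Upper bound. Taking `Γ = 0` in `starProd` shows that an admissible Hessian has its `x`-block in `F`.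
So `w(x) + k‖y - y₀‖²` with Hessian of `w` outside `F` cannot touch a competitor from above, and
comparison takes place on slices (`IsPerronCompetitor.le_of_slice`). Near `τ` one takes `w = const -
C ψ`, with `ψ` the barrier of `exists_local_barrier` for the dual of `F`.

Lower bound. The Hessian of `l(x) + u · y` is block diagonal with zero second block, and all its
graph pullbacks equal the Hessian of `l`. So the sum is subharmonic once that Hessian lies in `F`.
With `u` the slope of an affine minorant of `φ_τ`, the difficulty is to stay below `φ` for all `y`
at nearby boundary points. Finiteness of the conjugates around `u` and their uniform comparability
give `φ_τ'(y) ≥ u · y + η‖y‖ - M` for all `τ'`. Only a compact set of `y` then matters, and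
continuity suffices there (`LocallyComparable.exists_affine_le`). -/

/-- The quadratic form `v ↦ vᵀ A v` of a symmetric matrix. -/
def symQuad {ι : Type*} [Fintype ι] (A : SymMat ι) (v : ι → ℝ) : ℝ :=
  v ⬝ᵥ (A : Matrix ι ι ℝ).mulVec v

/-- Translation by `P` is a homeomorphism mapping `F` into `F`, so it maps the interior into itself;
apply this to `-(A + P)`. The dual thus has the only property of `F` that `exists_local_barrier`
needs. -/
theorem dirichletDual_add_mem {ι : Type*} {F : Set (SymMat ι)}
    (hF : ∀ A ∈ F, ∀ P ∈ posCone ι, A + P ∈ F) :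
    ∀ A ∈ dirichletDual F, ∀ P ∈ posCone ι, A + P ∈ dirichletDual F := by
  intro A hA P hP h
  refine hA ?_
  have h1 : (fun T : SymMat ι => T + P) '' interior F ⊆ interior F :=
    interior_maximal (by rintro _ ⟨T, hT, rfl⟩; exact hF T (interior_subset hT) P hP)
      ((Homeomorph.addRight P).isOpenMap _ isOpen_interior)
  have := h1 ⟨_, h, rfl⟩
  simpa using this

section SymQuad

variable {ι κ : Type*} [Fintype ι] [Fintype κ]

theorem symQuad_add (A B : SymMat ι) (v : ι → ℝ) :
    symQuad (A + B) v = symQuad A v + symQuad B v := by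
  simp [symQuad, Matrix.add_mulVec, dotProduct_add]

theorem symQuad_sub (A B : SymMat ι) (v : ι → ℝ) :
    symQuad (A - B) v = symQuad A v - symQuad B v := by
  simp [symQuad, Matrix.sub_mulVec, dotProduct_sub]

theorem symQuad_neg (A : SymMat ι) (v : ι → ℝ) : symQuad (-A) v = -symQuad A v := by
  simp [symQuad, Matrix.neg_mulVec]

theorem symQuad_smul (c : ℝ) (A : SymMat ι) (v : ι → ℝ) :
    symQuad (c • A) v = c * symQuad A v := by
  simp [symQuad, Matrix.smul_mulVec]

theorem symQuad_symOne [DecidableEq ι] (v : ι → ℝ) : symQuad (symOne ι) v = v ⬝ᵥ v := by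
  simp [symQuad, symOne]

theorem mem_posCone_iff {A : SymMat ι} : A ∈ posCone ι ↔ ∀ v, 0 ≤ symQuad A v := by
  refine ⟨fun h v => ?_, fun h => Matrix.PosSemidef.of_dotProduct_mulVec_nonneg ?_ fun v => ?_⟩
  · have := Matrix.PosSemidef.dotProduct_mulVec_nonneg h v
    simpa [symQuad] using this
  · exact A.2
  · simpa [symQuad] using h v

theorem dotProduct_self_nonneg' (v : ι → ℝ) : 0 ≤ v ⬝ᵥ v :=
  Finset.sum_nonneg fun k _ => mul_self_nonneg (v k)

theorem abs_symQuad_le (S : SymMat ι) (v : ι → ℝ) :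
    |symQuad S v| ≤ (∑ i, ∑ j, |(S : Matrix ι ι ℝ) i j|) * (v ⬝ᵥ v) := by
  have hv : ∀ i, v i ^ 2 ≤ v ⬝ᵥ v := fun i => by
    have h := Finset.single_le_sum (f := fun k => v k * v k)
      (fun k _ => mul_self_nonneg (v k)) (Finset.mem_univ i)
    simpa [dotProduct, sq] using h
  obtain ⟨q, hq⟩ : ∃ q, q = v ⬝ᵥ v := ⟨_, rfl⟩
  rw [← hq] at hv ⊢
  simp only [symQuad, dotProduct, Matrix.mulVec, Finset.sum_mul, Finset.mul_sum]
  refine (Finset.abs_sum_le_sum_abs _ _).trans (Finset.sum_le_sum fun i _ => ?_)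
  refine (Finset.abs_sum_le_sum_abs _ _).trans (Finset.sum_le_sum fun j _ => ?_)
  have hij : |v i * v j| ≤ q := by
    rw [abs_le]
    constructor <;> nlinarith [hv i, hv j, sq_nonneg (v i + v j), sq_nonneg (v i - v j)]
  have h4 : v i * ((S : Matrix ι ι ℝ) i j * v j) = (S : Matrix ι ι ℝ) i j * (v i * v j) := by ring
  rw [h4, abs_mul]
  exact mul_le_mul_of_nonneg_left hij (abs_nonneg _)

theorem eventually_abs_symQuad_sub_le (A : SymMat ι) {δ : ℝ} (hδ : 0 < δ) :
    ∀ᶠ A' in 𝓝 A, ∀ v, |symQuad A' v - symQuad A v| ≤ δ * (v ⬝ᵥ v) := by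
  have hc : Continuous fun A' : SymMat ι =>
      ∑ i, ∑ j, |((A' - A : SymMat ι) : Matrix ι ι ℝ) i j| := by
    refine continuous_finsetSum _ fun i _ => continuous_finsetSum _ fun j _ => ?_
    have : Continuous fun A' : SymMat ι => ((A' - A : SymMat ι) : Matrix ι ι ℝ) := by fun_prop
    exact (this.matrix_elem i j).abs
  have h := (hc.tendsto A).eventually_lt_const (u := δ) (by simpa using hδ)
  filter_upwards [h] with A' hA' v
  rw [← symQuad_sub]
  exact (abs_symQuad_le _ v).trans
    (mul_le_mul_of_nonneg_right hA'.le (dotProduct_self_nonneg' v))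

variable {F : Set (SymMat ι)}

theorem mem_of_symQuad_le (hF : ∀ A ∈ F, ∀ P ∈ posCone ι, A + P ∈ F) {A B : SymMat ι}
    (hA : A ∈ F) (h : ∀ v, symQuad A v ≤ symQuad B v) : B ∈ F := by
  have := hF A hA (B - A) (mem_posCone_iff.2 fun v => by
    rw [symQuad_sub]; exact sub_nonneg.2 (h v))
  simpa using this

theorem mem_interior_of_symQuad_add_le (hF : ∀ A ∈ F, ∀ P ∈ posCone ι, A + P ∈ F)
    {A B : SymMat ι} (hA : A ∈ F) {t : ℝ} (ht : 0 < t)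
    (h : ∀ v, symQuad A v + t * (v ⬝ᵥ v) ≤ symQuad B v) : B ∈ interior F := by
  rw [mem_interior_iff_mem_nhds]
  filter_upwards [eventually_abs_symQuad_sub_le B ht] with B' hB'
  refine mem_of_symQuad_le hF hA fun v => ?_
  linarith [h v, (abs_le.1 (hB' v)).1]

theorem IsDirichletSet.exists_forall_mem_of_le (hF : IsDirichletSet F) :
    ∃ t : ℝ, 0 ≤ t ∧ ∀ A : SymMat ι, (∀ v, t * (v ⬝ᵥ v) ≤ symQuad A v) → A ∈ F := by
  obtain ⟨A₁, hA₁⟩ := hF.nonempty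
  refine ⟨∑ i, ∑ j, |(A₁ : Matrix ι ι ℝ) i j|,
    Finset.sum_nonneg fun i _ => Finset.sum_nonneg fun j _ => abs_nonneg _, fun A hA => ?_⟩
  exact mem_of_symQuad_le hF.add_mem hA₁ fun v =>
    (le_abs_self _).trans ((abs_symQuad_le A₁ v).trans (hA v))

theorem IsDirichletSet.exists_forall_notMem_of_le (hF : IsDirichletSet F) :
    ∃ t : ℝ, 0 ≤ t ∧ ∀ A : SymMat ι, (∀ v, symQuad A v ≤ -t * (v ⬝ᵥ v)) → A ∉ F := by
  obtain ⟨A₀, hA₀⟩ := (ne_univ_iff_exists_notMem F).1 hF.ne_univ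
  refine ⟨∑ i, ∑ j, |(A₀ : Matrix ι ι ℝ) i j|,
    Finset.sum_nonneg fun i _ => Finset.sum_nonneg fun j _ => abs_nonneg _, fun A hA hAF => ?_⟩
  refine hA₀ (mem_of_symQuad_le hF.add_mem hAF fun v => ?_)
  linarith [hA v, neg_abs_le (symQuad A₀ v), abs_symQuad_le A₀ v]

/-- The term `-|v|²` is slack of fixed size: a single `C` yields membership with a whole identity
matrix to spare. This strictness is needed when the lemma is applied to the dual. -/
theorem exists_forall_mem_of_mem_interior_raySet
    (hF : ∀ A ∈ F, ∀ P ∈ posCone ι, A + P ∈ F) [DecidableEq ι] {A : SymMat ι}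
    (hA : A ∈ interior (raySet F)) :
    ∃ δ > 0, ∃ C₀ : ℝ, 0 < C₀ ∧ ∀ C ≥ C₀, ∀ B : SymMat ι,
      (∀ v, C * (symQuad A v - δ * (v ⬝ᵥ v)) - v ⬝ᵥ v ≤ symQuad B v) → B ∈ F := by
  have hlim : Tendsto (fun e : ℝ => A - e • symOne ι) (𝓝[>] 0) (𝓝 A) := by
    have h : Continuous fun e : ℝ => A - e • symOne ι := by fun_prop
    have h' := (h.tendsto 0).mono_left (nhdsWithin_le_nhds (s := Ioi (0 : ℝ)))
    simpa using h'
  obtain ⟨e, he, he0⟩ := ((hlim.eventually (mem_interior_iff_mem_nhds.1 hA)).and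
    self_mem_nhdsWithin).exists
  have he0 : 0 < e := he0
  -- Interior points of a closure need not lie on rays that stay in `F`. Hence step down by `e`,
  -- approximate by a genuine ray direction `A'` within `e / 2`, and obtain `A' ≤ A - e / 2`. Of the
  -- remaining `e / 2`, half becomes `δ`, and the other half absorbs the identity once `4 ≤ C * e`.
  obtain ⟨A', hA', l₀, hl₀⟩ := mem_closure_iff_nhds.1 he _
    (eventually_abs_symQuad_sub_le (A - e • symOne ι) (half_pos he0))
  refine ⟨e / 4, by positivity, max (max l₀ 1) (4 / e), by positivity, fun C hC B hB => ?_⟩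
  have hC0 : l₀ ≤ C := (le_max_left _ _).trans ((le_max_left _ _).trans hC)
  have hC1 : 1 ≤ C := (le_max_right l₀ 1).trans ((le_max_left _ _).trans hC)
  have hC2 : 4 ≤ C * e := by
    have := (le_max_right _ _).trans hC
    rwa [div_le_iff₀ he0] at this
  refine mem_of_symQuad_le hF (hl₀ C hC0) fun v => le_trans ?_ (hB v)
  have h1 := (abs_le.1 (hA' v)).2
  have h0 := dotProduct_self_nonneg' v
  rw [symQuad_sub, symQuad_smul, symQuad_symOne] at h1
  rw [zero_add, symQuad_smul]
  have h2 := mul_le_mul_of_nonneg_left h1 (zero_le_one.trans hC1)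
  nlinarith [mul_le_mul_of_nonneg_right hC2 h0]

/-! ### Blocks -/

theorem symQuad_graphPullback [DecidableEq ι] (Γ : Matrix κ ι ℝ) (A : SymMat (ι ⊕ κ))
    (v : ι → ℝ) :
    symQuad (graphPullback Γ A) v = symQuad A (Sum.elim v (Γ.mulVec v)) := by
  have h : (Matrix.fromRows (1 : Matrix ι ι ℝ) Γ).mulVec v = Sum.elim v (Γ.mulVec v) := by
    rw [Matrix.fromRows_mulVec, Matrix.one_mulVec]
  simp only [symQuad, graphPullback]
  rw [← Matrix.mulVec_mulVec, ← Matrix.mulVec_mulVec, h, Matrix.dotProduct_mulVec,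
    Matrix.vecMul_transpose, h]

theorem symQuad_blockPi (A : SymMat (ι ⊕ κ)) (w : κ → ℝ) :
    symQuad (blockPi A) w = symQuad A (Sum.elim 0 w) := by
  simp [symQuad, blockPi, dotProduct, Matrix.mulVec, Matrix.toBlocks₂₂]

theorem isClosed_starProd [DecidableEq ι] (hF : IsClosed F) {G : Set (SymMat κ)}
    (hG : IsClosed G) : IsClosed (starProd F G) := by
  have h1 : Continuous (blockPi : SymMat (ι ⊕ κ) → SymMat κ) := by
    refine Continuous.subtype_mk ?_ _
    exact continuous_matrix fun i j => continuous_subtype_val.matrix_elem _ _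
  have h2 : ∀ Γ : Matrix κ ι ℝ, Continuous (graphPullback Γ) := fun Γ => by
    refine Continuous.subtype_mk ?_ _
    exact (continuous_const.matrix_mul continuous_subtype_val).matrix_mul continuous_const
  rw [starProd, ofPred_and, ofPred_forall]
  exact (hG.preimage h1).inter (isClosed_iInter fun Γ => hF.preimage (h2 Γ))

theorem isClosed_posCone : IsClosed (posCone ι) := by
  have : posCone ι = ⋂ v, {A | 0 ≤ symQuad A v} := by
    ext A; simp [mem_posCone_iff]
  rw [this]
  refine isClosed_iInter fun v => isClosed_le continuous_const ?_
  exact continuous_const.dotProduct (continuous_subtype_val.matrix_mulVec continuous_const)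

end SymQuad

/-! ### Second derivatives along lines -/

section SecondDeriv

variable {V : Type*} [NormedAddCommGroup V] [NormedSpace ℝ V]

/-- The second derivative of `g` at `z` in the direction `v`. -/
noncomputable def secondDeriv (g : V → ℝ) (z v : V) : ℝ :=
  fderiv ℝ (fderiv ℝ g) z v v

/-- If `c < 0`, the second derivative test makes `0` a local maximum too, so `f` is locally constant
and `c = 0`. -/
theorem nonneg_of_isLocalMin_of_hasDerivAt {f f' : ℝ → ℝ} {c : ℝ}
    (hf : ∀ᶠ t in 𝓝 0, HasDerivAt f (f' t) t) (hf' : HasDerivAt f' c 0)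
    (hmin : IsLocalMin f 0) : 0 ≤ c := by
  by_contra! hc
  have h1 : deriv f =ᶠ[𝓝 0] f' := hf.mono fun t ht => ht.deriv
  have h2 : deriv (deriv f) 0 = c := by rw [h1.deriv_eq, hf'.deriv]
  have hmax := isLocalMax_of_deriv_deriv_neg (h2 ▸ hc) hmin.deriv_eq_zero
    hf.self_of_nhds.continuousAt
  have h3 : f =ᶠ[𝓝 0] fun _ => f 0 := by
    filter_upwards [hmin, hmax] with t h4 h5 using le_antisymm h5 h4
  have h6 : deriv f =ᶠ[𝓝 0] fun _ => 0 := by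
    filter_upwards [h3.eventuallyEq_nhds] with t ht
    rw [ht.deriv_eq, deriv_const]
  rw [h6.deriv_eq, deriv_const] at h2
  linarith

theorem ContDiffAt.differentiableAt_fderiv {g : V → ℝ} {z : V} (hg : ContDiffAt ℝ 2 g z) :
    DifferentiableAt ℝ (fderiv ℝ g) z :=
  (hg.fderiv_right (m := 1) (by norm_num)).differentiableAt (by norm_num)

theorem hasDerivAt_add_smul (z v : V) (t : ℝ) : HasDerivAt (fun t : ℝ => z + t • v) v t := by
  simpa using ((hasDerivAt_id t).smul_const v).const_add z

theorem ContDiffAt.eventually_hasDerivAt_line {g : V → ℝ} {z : V} (hg : ContDiffAt ℝ 2 g z)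
    (v : V) : ∀ᶠ t : ℝ in 𝓝 0,
      HasDerivAt (fun t : ℝ => g (z + t • v)) (fderiv ℝ g (z + t • v) v) t := by
  have h1 : ∀ᶠ z' in 𝓝 z, DifferentiableAt ℝ g z' := by
    filter_upwards [hg.eventually (by simp)] with z' hz'
    exact hz'.differentiableAt (by norm_num)
  have h2 : Tendsto (fun t : ℝ => z + t • v) (𝓝 0) (𝓝 z) := by
    simpa using (hasDerivAt_add_smul z v 0).continuousAt.tendsto
  filter_upwards [h2.eventually h1] with t ht
  exact ht.hasFDerivAt.comp_hasDerivAt t (hasDerivAt_add_smul z v t)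

theorem ContDiffAt.hasDerivAt_fderiv_line {g : V → ℝ} {z : V} (hg : ContDiffAt ℝ 2 g z)
    (v : V) : HasDerivAt (fun t : ℝ => fderiv ℝ g (z + t • v) v) (secondDeriv g z v) 0 := by
  have h1 : HasFDerivAt (fderiv ℝ g) (fderiv ℝ (fderiv ℝ g) z) (z + (0 : ℝ) • v) := by
    simpa using hg.differentiableAt_fderiv.hasFDerivAt
  have h2 := h1.comp_hasDerivAt (0 : ℝ) (hasDerivAt_add_smul z v 0)
  simpa [secondDeriv] using h2.clm_apply (hasDerivAt_const (0 : ℝ) v)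

/-- Reduces each second derivative of an explicit function to one-variable calculus along a line. -/
theorem ContDiffAt.secondDeriv_eq {g : V → ℝ} {z v : V} (hg : ContDiffAt ℝ 2 g z)
    {k : ℝ → ℝ} {c : ℝ} (hk : ∀ᶠ t : ℝ in 𝓝 0, HasDerivAt (fun t : ℝ => g (z + t • v)) (k t) t)
    (hc : HasDerivAt k c 0) : secondDeriv g z v = c := by
  have h1 : (fun t : ℝ => fderiv ℝ g (z + t • v) v) =ᶠ[𝓝 0] k := by
    filter_upwards [hk, hg.eventually_hasDerivAt_line v] with t h2 h3 using h3.unique h2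
  exact (h1.hasDerivAt_iff.1 (hg.hasDerivAt_fderiv_line v)).unique hc

theorem secondDeriv_mono_of_isLocalMin_sub {g p : V → ℝ} {z : V} (hg : ContDiffAt ℝ 2 g z)
    (hp : ContDiffAt ℝ 2 p z) (h : IsLocalMin (fun z => g z - p z) z) (v : V) :
    secondDeriv p z v ≤ secondDeriv g z v := by
  refine sub_nonneg.1 (nonneg_of_isLocalMin_of_hasDerivAt
    (f := fun t : ℝ => g (z + t • v) - p (z + t • v)) ?_
    ((hg.hasDerivAt_fderiv_line v).sub (hp.hasDerivAt_fderiv_line v)) ?_)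
  · filter_upwards [hg.eventually_hasDerivAt_line v, hp.eventually_hasDerivAt_line v]
      with t h1 h2 using h1.sub h2
  · have h2 : Tendsto (fun t : ℝ => z + t • v) (𝓝 0) (𝓝 z) := by
      simpa using (hasDerivAt_add_smul z v 0).continuousAt.tendsto
    have := h2.eventually h
    filter_upwards [this] with t ht
    simpa using ht

theorem fderiv_fderiv_add_const_mul {g q : V → ℝ} {z : V} (hg : ContDiffAt ℝ 2 g z)
    (hq : ContDiffAt ℝ 2 q z) (e : ℝ) :
    fderiv ℝ (fderiv ℝ fun z => g z + e * q z) z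
      = fderiv ℝ (fderiv ℝ g) z + e • fderiv ℝ (fderiv ℝ q) z := by
  have h1 : (fderiv ℝ fun z => g z + e * q z) =ᶠ[𝓝 z]
      fun z => fderiv ℝ g z + e • fderiv ℝ q z := by
    filter_upwards [hg.eventually (by simp), hq.eventually (by simp)] with z' h2 h3
    have h2 := (h2.differentiableAt (by norm_num)).hasFDerivAt
    have h3 := (h3.differentiableAt (by norm_num)).hasFDerivAt
    exact (h2.add (h3.const_mul e)).fderiv
  rw [h1.fderiv_eq]
  exact (hg.differentiableAt_fderiv.hasFDerivAt.add
    (hq.differentiableAt_fderiv.hasFDerivAt.const_smul e)).fderiv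

theorem secondDeriv_add_const_mul {g q : V → ℝ} {z : V} (hg : ContDiffAt ℝ 2 g z)
    (hq : ContDiffAt ℝ 2 q z) (e : ℝ) (v : V) :
    secondDeriv (fun z => g z + e * q z) z v = secondDeriv g z v + e * secondDeriv q z v := by
  simp [secondDeriv, fderiv_fderiv_add_const_mul hg hq e]

theorem secondDeriv_const (c : ℝ) (z v : V) : secondDeriv (fun _ => c) z v = 0 := by
  have : (fderiv ℝ fun _ : V => c) = fun _ => 0 := by ext; simp
  simp [secondDeriv, this]

theorem secondDeriv_norm_sub_sq {E : Type*} [NormedAddCommGroup E] [InnerProductSpace ℝ E]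
    (a z v : E) : secondDeriv (fun x => ‖x - a‖ ^ 2) z v = 2 * ‖v‖ ^ 2 := by
  have h : (fderiv ℝ fun x => ‖x - a‖ ^ 2) = fun x => (2 : ℝ) • innerSL ℝ (x - a) := by
    ext x w
    have := ((hasFDerivAt_id x).sub_const a).norm_sq.fderiv
    simp only [id] at this
    rw [this]
    simp
  have h2 : HasFDerivAt (fun x : E => (2 : ℝ) • innerSL ℝ (x - a))
      ((2 : ℝ) • (innerSL ℝ : E →L[ℝ] E →L[ℝ] ℝ)) z := by
    have h3 := ((innerSL ℝ : E →L[ℝ] E →L[ℝ] ℝ).hasFDerivAt (x := z - a)).comp z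
      ((hasFDerivAt_id z).sub_const a)
    exact h3.const_smul (2 : ℝ)
  rw [secondDeriv, h, h2.fderiv, ← real_inner_self_eq_norm_sq]
  rfl

end SecondDeriv

/-! ### Hessian matrices -/

section Hessian

variable {ι V : Type*} [NormedAddCommGroup V] [NormedSpace ℝ V] (b : Module.Basis ι ℝ V)

theorem exists_coe_eq_hessMatrix {g : V → ℝ} {z : V} (hg : ContDiffAt ℝ 2 g z) :
    ∃ A : SymMat ι, (A : Matrix ι ι ℝ) = hessMatrix b g z := by
  refine ⟨⟨hessMatrix b g z, ?_⟩, rfl⟩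
  refine Matrix.IsSymm.ext fun i j => ?_
  exact (hg.isSymmSndFDerivAt (by simp)) _ _

theorem symQuad_eq_secondDeriv [Fintype ι] {g : V → ℝ} {z : V} {A : SymMat ι}
    (hA : (A : Matrix ι ι ℝ) = hessMatrix b g z) (x : ι → ℝ) :
    symQuad A x = secondDeriv g z (∑ i, x i • b i) := by
  simp only [symQuad, hA, secondDeriv, dotProduct, Matrix.mulVec, hessMatrix, Matrix.of_apply,
    map_sum, map_smul, _root_.sum_apply, _root_.smul_apply,
    smul_eq_mul, Finset.mul_sum]
  rw [Finset.sum_comm]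
  refine Finset.sum_congr rfl fun i _ => Finset.sum_congr rfl fun j _ => ?_
  ring

theorem ContDiffOn.continuousOn_hessMatrix {g : V → ℝ} {U : Set V} (hU : IsOpen U)
    (hg : ContDiffOn ℝ ∞ g U) : ContinuousOn (hessMatrix b g) U := by
  have h1 : ContDiffOn ℝ ∞ (fderiv ℝ g) U := hg.fderiv_of_isOpen hU (by simp)
  have h2 : ContDiffOn ℝ ∞ (fderiv ℝ (fderiv ℝ g)) U := h1.fderiv_of_isOpen hU (by simp)
  have h3 := h2.continuousOn
  refine continuousOn_pi.2 fun i => continuousOn_pi.2 fun j => ?_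
  exact (h3.clm_apply continuousOn_const).clm_apply continuousOn_const

/-- Since `hessMatrix` takes values in all matrices, this turns "the Hessian is not in `G`" into an
open condition. -/
theorem isClosed_image_coe_symMat {G : Set (SymMat ι)} (hG : IsClosed G) :
    IsClosed ((fun A : SymMat ι => (A : Matrix ι ι ℝ)) '' G) := by
  have h : IsClosed {A : Matrix ι ι ℝ | A.IsSymm} :=
    isClosed_eq (by fun_prop) continuous_id
  exact h.isClosedMap_subtype_val _ hG

variable {n m : ℕ}

theorem sum_smul_stdBasis (x : Fin n → ℝ) : ∑ i, x i • stdBasis n i = WithLp.toLp 2 x := by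
  have := (stdBasis n).sum_equivFun (WithLp.toLp 2 x)
  simpa [stdBasis] using this

theorem symQuad_eq_secondDeriv_std {g : EuclideanSpace ℝ (Fin n) → ℝ}
    {z : EuclideanSpace ℝ (Fin n)} {A : SymMat (Fin n)}
    (hA : (A : Matrix (Fin n) (Fin n) ℝ) = hessMatrix (stdBasis n) g z) (x : Fin n → ℝ) :
    symQuad A x = secondDeriv g z (WithLp.toLp 2 x) := by
  rw [symQuad_eq_secondDeriv _ hA, sum_smul_stdBasis]

theorem symQuad_eq_secondDeriv_prod {g : EuclideanSpace ℝ (Fin n) × EuclideanSpace ℝ (Fin m) → ℝ}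
    {z : EuclideanSpace ℝ (Fin n) × EuclideanSpace ℝ (Fin m)} {A : SymMat (Fin n ⊕ Fin m)}
    (hA : (A : Matrix (Fin n ⊕ Fin m) (Fin n ⊕ Fin m) ℝ) = hessMatrix (stdBasisProd n m) g z)
    (x : Fin n → ℝ) (y : Fin m → ℝ) :
    symQuad A (Sum.elim x y) = secondDeriv g z (WithLp.toLp 2 x, WithLp.toLp 2 y) := by
  rw [symQuad_eq_secondDeriv _ hA, ← sum_smul_stdBasis, ← sum_smul_stdBasis]
  congr 1
  ext1 <;> simp [stdBasisProd, Prod.fst_sum, Prod.snd_sum]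

theorem dotProduct_self_eq_norm_sq (x : Fin n → ℝ) : x ⬝ᵥ x = ‖WithLp.toLp 2 x‖ ^ 2 := by
  rw [EuclideanSpace.norm_sq_eq]
  simp [dotProduct, sq]

end Hessian

/-! ### The maximum principle and upper envelopes -/

section Envelope

theorem EReal.add_coe_neg_le_iff {a : EReal} {p c : ℝ} :
    a + ((-p : ℝ) : EReal) ≤ (c : EReal) ↔ a ≤ ((p + c : ℝ) : EReal) := by
  induction a with
  | bot => simp
  | top =>
    have : ¬((p + c : ℝ) : EReal) = ⊤ := EReal.coe_ne_top _
    simpa using this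
  | coe a => norm_cast; constructor <;> intro h <;> linarith

theorem upperSemicontinuousOn_add_coe {V : Type*} [TopologicalSpace V] {f : V → EReal}
    {p : V → ℝ} {K : Set V} (hf : UpperSemicontinuousOn f K) (hp : ContinuousOn p K) :
    UpperSemicontinuousOn (fun z => f z + (p z : EReal)) K := by
  refine hf.add' ?_ fun z _ => EReal.continuousAt_add (by simp) (by simp)
  exact (continuous_coe_real_ereal.comp_continuousOn hp).upperSemicontinuousOn

section

variable {V : Type*} [TopologicalSpace V]

/-- The upper semicontinuous regularization of `f` on `S`. -/
noncomputable def uscReg (S : Set V) (f : V → EReal) (z : V) : EReal :=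
  limsup f (𝓝[S] z)

theorem uscReg_le {S : Set V} {f : V → EReal} {z : V} {c : EReal}
    (h : ∀ᶠ z' in 𝓝[S] z, f z' ≤ c) : uscReg S f z ≤ c :=
  limsup_le_of_le (h := h)

theorem upperSemicontinuousOn_uscReg (S : Set V) (f : V → EReal) :
    UpperSemicontinuousOn (uscReg S f) S := by
  intro z _ c hc
  obtain ⟨c', h1, h2⟩ := exists_between hc
  have h3 : ∀ᶠ z' in 𝓝[S] z, f z' < c' := eventually_lt_of_limsup_lt h1
  filter_upwards [eventually_eventually_nhdsWithin.2 h3] with z' hz'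
  exact (uscReg_le (hz'.mono fun _ h => h.le)).trans_lt h2

theorem le_uscReg {S : Set V} {f : V → EReal} {z : V} (hz : z ∈ S) : f z ≤ uscReg S f z := by
  refine le_limsup_of_le (h := fun c hc => ?_)
  exact hc.self_of_nhdsWithin hz

end

variable {ι V : Type*} [NormedAddCommGroup V] [NormedSpace ℝ V] {b : Module.Basis ι ℝ V}
  {G : Set (SymMat ι)} {X : Set V}

/-- A function whose Hessian is nowhere in `G` dominates a `G`-subharmonic function as soon as
it does so outside the region where it is smooth. -/
theorem IsFSubharmonicOn.le_of_hess_notMem {f : V → EReal} (hf : IsFSubharmonicOn b G X f)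
    {K W : Set V} (hK : IsCompact K) (hfK : UpperSemicontinuousOn f K) (hW : IsOpen W)
    (hWK : W ⊆ K) (hWX : W ⊆ X) {p : V → ℝ} (hpK : ContinuousOn p K) (hp : ContDiffOn ℝ ∞ p W)
    (hG : ∀ z ∈ W, ¬∃ A ∈ G, (A : Matrix ι ι ℝ) = hessMatrix b p z)
    (hbd : ∀ z ∈ K \ W, f z ≤ (p z : EReal)) : ∀ z ∈ K, f z ≤ (p z : EReal) := by
  by_contra! hne
  obtain ⟨z₀, hz₀, hlt⟩ := hne
  -- At a maximum of `f - p` with positive value, a vertical translate of `p` is a test function for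
  -- `f`, which forces the Hessian of `p` into `G`.
  obtain ⟨z₁, hz₁, hmax⟩ := (upperSemicontinuousOn_add_coe hfK hpK.neg).exists_isMaxOn
    ⟨z₀, hz₀⟩ hK
  have hpos : (p z₁ : EReal) < f z₁ := by
    by_contra! h
    have h1 := hmax hz₀
    have h2 : f z₁ + ((-p z₁ : ℝ) : EReal) ≤ ((0 : ℝ) : EReal) :=
      EReal.add_coe_neg_le_iff.2 (by simpa using h)
    have h3 := EReal.add_coe_neg_le_iff.1 (h1.trans h2)
    rw [add_zero] at h3
    exact absurd hlt (not_lt.2 h3)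
  have hzW : z₁ ∈ W := by
    by_contra h
    exact absurd hpos (not_lt.2 (hbd z₁ ⟨hz₁, h⟩))
  obtain ⟨a, ha⟩ : ∃ a : ℝ, f z₁ = a := by
    have h1 := hf.ne_top z₁ (hWX hzW)
    have h2 : f z₁ ≠ ⊥ := ((bot_le).trans_lt hpos).ne'
    exact ⟨(f z₁).toReal, (EReal.coe_toReal h1 h2).symm⟩
  have htest : IsTestFunctionAt X f z₁ fun z => p z + (a - p z₁) := by
    refine ⟨W, hW, hzW, hWX, hp.add contDiffOn_const, fun z hz => ?_, by simp [ha]⟩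
    have h1 : f z + ((-p z : ℝ) : EReal) ≤ f z₁ + ((-p z₁ : ℝ) : EReal) := hmax (hWK hz)
    rw [ha, ← EReal.coe_add] at h1
    exact EReal.add_coe_neg_le_iff.1 h1
  obtain ⟨A, hA, hAe⟩ := hf.hess_mem z₁ (hWX hzW) _ htest
  refine hG z₁ hzW ⟨A, hA, hAe.trans ?_⟩
  have : (fderiv ℝ fun z => p z + (a - p z₁)) = fderiv ℝ p := by
    ext z; simp
  simp [hessMatrix, this]

/-- If a test function `g` had its Hessian outside the closed set `G` at `z₀`, then `g + e q - μ`
would have it outside `G` on a small ball and would dominate the family on the sphere, hence on the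
ball. This pushes the regularization strictly below `g z₀`. The bump `q` is a parameter because the
norm of `V` may fail to be smooth, as for the sup norm on a product. -/
theorem isFSubharmonicOn_uscReg [FiniteDimensional ℝ V] (hG : IsClosed G)
    {S : Set V} (hXS : X ⊆ S) (q : V → V → ℝ) (hq : ∀ a, ContDiff ℝ ∞ (q a))
    (hq0 : ∀ a, q a a = 0) (hqpos : ∀ a z, z ≠ a → 0 < q a z)
    {𝓕 : Set (V → EReal)} (h𝓕 : ∀ f ∈ 𝓕, IsFSubharmonicOn b G X f)
    {f : V → EReal} (hf : IsLUB 𝓕 f) (htop : ∀ z ∈ X, uscReg S f z ≠ ⊤) :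
    IsFSubharmonicOn b G X (uscReg S f) := by
  refine ⟨(upperSemicontinuousOn_uscReg S f).mono hXS, htop, fun z₀ hz₀ g hg => ?_⟩
  obtain ⟨U, hU, hzU, hUX, hgU, hle, heq⟩ := hg
  by_contra hne
  have hgat : ∀ z ∈ U, ContDiffAt ℝ 2 g z := fun z hz =>
    (hgU.contDiffAt (hU.mem_nhds hz)).of_le (by norm_cast)
  have hqat : ∀ z, ContDiffAt ℝ 2 (q z₀) z := fun z =>
    (hq z₀).contDiffAt.of_le (by norm_cast)
  have hcont : ContinuousOn
      (fun w : ℝ × V => hessMatrix b g w.2 + w.1 • hessMatrix b (q z₀) w.2) (univ ×ˢ U) := by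
    have h1 := (hgU.continuousOn_hessMatrix b hU).comp (t := U) (s := (univ : Set ℝ) ×ˢ U)
      continuousOn_snd fun w hw => hw.2
    have h2 := ((hq z₀).contDiffOn.continuousOn_hessMatrix b hU).comp (s := (univ : Set ℝ) ×ˢ U)
      continuousOn_snd fun w hw => hw.2
    exact h1.add (continuousOn_fst.smul h2)
  have hnm : ∀ᶠ w : ℝ × V in 𝓝 (0, z₀), w.2 ∈ U ∧
      hessMatrix b g w.2 + w.1 • hessMatrix b (q z₀) w.2 ∉
        (fun A : SymMat ι => (A : Matrix ι ι ℝ)) '' G := by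
    have hop : (univ : Set ℝ) ×ˢ U ∈ 𝓝 ((0 : ℝ), z₀) :=
      (isOpen_univ.prod hU).mem_nhds ⟨trivial, hzU⟩
    have h1 := (hcont.continuousAt hop).eventually
      ((isClosed_image_coe_symMat hG).isOpen_compl.mem_nhds (x := hessMatrix b g z₀ +
        (0 : ℝ) • hessMatrix b (q z₀) z₀) (by
          rw [zero_smul, add_zero]
          rintro ⟨A, hA, hAe⟩
          exact hne ⟨A, hA, hAe⟩))
    filter_upwards [h1, hop] with w h2 h3 using ⟨h3.2, h2⟩
  rw [nhds_prod_eq, eventually_prod_iff] at hnm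
  obtain ⟨pa, hpa, pb, hpb, hab⟩ := hnm
  obtain ⟨e, he, he0⟩ := ((hpa.filter_mono (nhdsWithin_le_nhds (s := Ioi 0))).and
    self_mem_nhdsWithin).exists
  have he0 : 0 < e := he0
  obtain ⟨r, hr, hball⟩ := Metric.nhds_basis_closedBall.eventually_iff.1 hpb
  have hballU : Metric.closedBall z₀ r ⊆ U := fun z hz => (hab he (hball hz)).1
  have : ProperSpace V := FiniteDimensional.proper ℝ V
  -- `μ` is a positive lower bound of `e q` on the sphere, so subtracting it keeps the comparison
  -- function above `g` there while lowering it at the centre.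
  obtain ⟨μ, hμ, hμle⟩ := (isCompact_sphere z₀ r).exists_forall_le' (f := fun z => e * q z₀ z)
    (a := 0) ((hq z₀).continuous.continuousOn.const_mul e) fun z hz =>
      mul_pos he0 (hqpos _ _ (Metric.ne_of_mem_sphere hz hr.ne'))
  set p : V → ℝ := fun z => g z + e * q z₀ z + -μ with hp
  have hpU : ContDiffOn ℝ ∞ p U :=
    (hgU.add (contDiffOn_const.mul (hq z₀).contDiffOn)).add contDiffOn_const
  have hpp : (fderiv ℝ p) = fderiv ℝ fun z => g z + e * q z₀ z := by
    ext z; simp [hp]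
  have key : ∀ h ∈ 𝓕, ∀ z ∈ Metric.closedBall z₀ r, h z ≤ (p z : EReal) := by
    intro h hh
    refine (h𝓕 h hh).le_of_hess_notMem (isCompact_closedBall z₀ r)
      ((h𝓕 h hh).usc.mono (hballU.trans hUX)) Metric.isOpen_ball Metric.ball_subset_closedBall
      ((Metric.ball_subset_closedBall.trans hballU).trans hUX) (hpU.continuousOn.mono hballU)
      (hpU.mono (Metric.ball_subset_closedBall.trans hballU)) ?_ ?_
    · rintro z hz ⟨A, hA, hAe⟩
      have hzc := Metric.ball_subset_closedBall hz
      refine (hab he (hball hzc)).2 ⟨A, hA, hAe.trans ?_⟩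
      ext i j
      simp [hessMatrix, hpp, fderiv_fderiv_add_const_mul (hgat z (hballU hzc)) (hqat z) e]
    · rintro z ⟨hz1, hz2⟩
      have hzs : z ∈ Metric.sphere z₀ r := by
        rw [Metric.mem_ball, not_lt] at hz2
        exact le_antisymm hz1 hz2
      have h1 : h z ≤ (g z : EReal) :=
        (hf.1 hh z).trans ((le_uscReg (hXS (hUX (hballU hz1)))).trans (hle z (hballU hz1)))
      refine h1.trans (EReal.coe_le_coe_iff.2 ?_)
      have := hμle z hzs
      simp only [hp]
      linarith
  classical
  have h1 : ∀ᶠ z in 𝓝[S] z₀, f z ≤ ((g z₀ - μ / 2 : ℝ) : EReal) := by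
    have hpc : Tendsto p (𝓝 z₀) (𝓝 (p z₀)) := (hpU.continuousOn.continuousAt (hU.mem_nhds hzU))
    have hp0 : p z₀ < g z₀ - μ / 2 := by simp only [hp, hq0]; linarith
    refine Filter.Eventually.filter_mono nhdsWithin_le_nhds ?_
    filter_upwards [hpc.eventually_lt_const hp0, Metric.closedBall_mem_nhds z₀ hr] with z h2 h3
    have h4 : f z ≤ (p z : EReal) := by
      -- The supremum is taken among functions; changing `f` at the single point `z` still gives an
      -- upper bound, so the bound holds pointwise.
      have h5 : f ≤ Function.update f z (p z : EReal) := hf.2 fun h hh z' => by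
        by_cases hz' : z' = z
        · subst hz'; simpa using key h hh z' h3
        · simpa [hz'] using hf.1 hh z'
      simpa using h5 z
    exact h4.trans (EReal.coe_le_coe_iff.2 h2.le)
  have h2 := uscReg_le h1
  rw [heq, EReal.coe_le_coe_iff] at h2
  linarith

end Envelope

/-! ### Local barriers at strictly convex boundary points -/

section Barrier

/-- Choose `e` with `l e = 1`. Since `v - l v • e` lies in the kernel of `l`, every term of `S v v`
carries a factor `l v`, and the mixed term is absorbed by completing the square. This is how a
condition on the tangent space becomes one on all directions. -/
theorem LinearMap.exists_neg_mul_norm_sq_le {E : Type*} [NormedAddCommGroup E] [NormedSpace ℝ E]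
    [FiniteDimensional ℝ E] (S : E →ₗ[ℝ] E →ₗ[ℝ] ℝ) (l : E →ₗ[ℝ] ℝ) (hl : l ≠ 0)
    (hS : ∀ v w, l v = 0 → l w = 0 → S v w = 0) {δ : ℝ} (hδ : 0 < δ) :
    ∃ c : ℝ, 0 ≤ c ∧ ∀ v, -(δ * ‖v‖ ^ 2) ≤ S v v + c * l v ^ 2 := by
  obtain ⟨e, he⟩ : ∃ e, l e = 1 := by
    obtain ⟨e, he⟩ := DFunLike.ne_iff.1 hl
    exact ⟨(l e)⁻¹ • e, by simpa using inv_mul_cancel₀ he⟩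
  obtain ⟨M, hM0, hM⟩ : ∃ M : ℝ, 0 ≤ M ∧ ∀ v, |S v e + S e v| ≤ M * ‖v‖ :=
    ⟨‖(S.flip e + S e).toContinuousLinearMap‖, norm_nonneg _,
      fun v => (S.flip e + S e).toContinuousLinearMap.le_opNorm v⟩
  refine ⟨M ^ 2 / (4 * δ) + |S e e|, by positivity, fun v => ?_⟩
  have h1 : S v v = l v * (S v e + S e v) - l v ^ 2 * S e e := by
    have h := hS (v - l v • e) (v - l v • e) (by simp [he]) (by simp [he])
    simp only [map_sub, map_smul, LinearMap.sub_apply, LinearMap.smul_apply, smul_eq_mul] at h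
    linarith
  have h2 : |l v * (S v e + S e v)| ≤ |l v| * (M * ‖v‖) := by
    rw [abs_mul]; exact mul_le_mul_of_nonneg_left (hM v) (abs_nonneg _)
  have h3 : |l v| * (M * ‖v‖) ≤ δ * ‖v‖ ^ 2 + M ^ 2 / (4 * δ) * l v ^ 2 := by
    have h4 : δ * ‖v‖ ^ 2 + M ^ 2 / (4 * δ) * l v ^ 2 - |l v| * (M * ‖v‖)
        = (2 * δ * ‖v‖ - M * |l v|) ^ 2 / (4 * δ) := by
      rw [← sq_abs (l v)]; field_simp; ring
    have h5 : 0 ≤ (2 * δ * ‖v‖ - M * |l v|) ^ 2 / (4 * δ) := by positivity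
    linarith
  have h6 := mul_le_mul_of_nonneg_left (le_abs_self (S e e)) (sq_nonneg (l v))
  rw [h1]
  linarith [neg_abs_le (l v * (S v e + S e v))]

variable {n : ℕ} {Ω U : Set (EuclideanSpace ℝ (Fin n))} {τ : EuclideanSpace ℝ (Fin n)}
  {ρ : EuclideanSpace ℝ (Fin n) → ℝ}

theorem IsLocalDefiningFunction.nonpos (hρ : IsLocalDefiningFunction Ω τ U ρ)
    {x : EuclideanSpace ℝ (Fin n)} (hx : x ∈ closure Ω) (hxU : x ∈ U) : ρ x ≤ 0 := by
  by_contra! h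
  have h1 : ∀ᶠ x' in 𝓝 x, 0 < ρ x' :=
    (hρ.smooth.continuousOn.continuousAt (hρ.isOpen.mem_nhds hxU)).eventually_const_lt h
  obtain ⟨x', ⟨h2, h3⟩, hx'⟩ := mem_closure_iff_nhds.1 hx _ (h1.and (hρ.isOpen.mem_nhds hxU))
  exact absurd ((hρ.neg_iff x' h3).1 hx') (not_lt.2 h2.le)

theorem IsLocalDefiningFunction.eq_zero (hρ : IsLocalDefiningFunction Ω τ U ρ) (hΩ : IsOpen Ω)
    (hτ : τ ∈ frontier Ω) : ρ τ = 0 := by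
  rw [hΩ.frontier_eq] at hτ
  refine le_antisymm (hρ.nonpos hτ.1 hρ.mem) (not_lt.1 fun h => hτ.2 ?_)
  exact (hρ.neg_iff τ hρ.mem).2 h

theorem ContDiffAt.secondDeriv_add_mul_sq {V : Type*} [NormedAddCommGroup V] [NormedSpace ℝ V]
    {g : V → ℝ} {z : V} (hg : ContDiffAt ℝ 2 g z) (hz : g z = 0) (c : ℝ) (v : V) :
    secondDeriv (fun x => g x + c * g x ^ 2) z v
      = secondDeriv g z v + 2 * c * fderiv ℝ g z v ^ 2 := by
  have h1 := hg.eventually_hasDerivAt_line v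
  refine ContDiffAt.secondDeriv_eq (hg.add (contDiffAt_const.mul (hg.pow 2)))
    (k := fun t => fderiv ℝ g (z + t • v) v + c * (2 * (g (z + t • v) * fderiv ℝ g (z + t • v) v)))
    ?_ ?_
  · filter_upwards [h1] with t ht
    refine (ht.add ((ht.pow 2).const_mul c)).congr_deriv ?_
    simp only [Nat.cast_ofNat, Nat.add_one_sub_one, pow_one]
    ring
  · have h2 := hg.hasDerivAt_fderiv_line v
    refine (h2.add (((h1.self_of_nhds.mul h2).const_mul 2).const_mul c)).congr_deriv ?_
    simp [hz]; ring

theorem eventually_secondDeriv_ge {g : EuclideanSpace ℝ (Fin n) → ℝ} (hU : IsOpen U)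
    (hτ : τ ∈ U) (hg : ContDiffOn ℝ ∞ g U) {δ : ℝ} (hδ : 0 < δ) :
    ∀ᶠ x in 𝓝 τ, ∀ v, secondDeriv g τ v - δ * ‖v‖ ^ 2 ≤ secondDeriv g x v := by
  have hat : ∀ x ∈ U, ContDiffAt ℝ 2 g x := fun x hx =>
    (hg.contDiffAt (hU.mem_nhds hx)).of_le (by norm_cast)
  obtain ⟨A, hA⟩ := exists_coe_eq_hessMatrix (stdBasis n) (hat τ hτ)
  have h1 := eventually_abs_symQuad_sub_le A hδ
  rw [nhds_subtype, eventually_comap, hA] at h1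
  filter_upwards [((hg.continuousOn_hessMatrix (stdBasis n) hU).continuousAt
    (hU.mem_nhds hτ)).eventually h1, hU.mem_nhds hτ] with x hx hxU v
  obtain ⟨A', hA'⟩ := exists_coe_eq_hessMatrix (stdBasis n) (hat x hxU)
  have h2 := (abs_le.1 (hx A' hA' v.ofLp)).1
  rw [symQuad_eq_secondDeriv_std hA', symQuad_eq_secondDeriv_std hA,
    dotProduct_self_eq_norm_sq] at h2
  simp only [WithLp.toLp_ofLp] at h2
  linarith

/-- The barrier is `ψ = ρ + (c/2) ρ² - (δ/8)‖x - τ‖²`. The square adds `c (dρ)²` to the Hessian at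
`τ`, which controls the directions transverse to the boundary; the last term makes `ψ` strictly
negative on `closure Ω` away from `τ`. -/
theorem exists_local_barrier {F : Set (SymMat (Fin n))}
    (hF : ∀ A ∈ F, ∀ P ∈ posCone (Fin n), A + P ∈ F) (hΩ : IsOpen Ω)
    (hΩF : IsStrictlyRayConvex F Ω) (hτ : τ ∈ frontier Ω) :
    ∃ r > 0, ∃ ε > 0, ∃ ψ : EuclideanSpace ℝ (Fin n) → ℝ,
      ContDiffOn ℝ ∞ ψ (Metric.ball τ r) ∧ ψ τ = 0 ∧
      (∀ x ∈ closure Ω, x ∈ Metric.ball τ r → ψ x ≤ -(ε * ‖x - τ‖ ^ 2)) ∧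
      ∃ C₀ : ℝ, 0 < C₀ ∧ ∀ C ≥ C₀, ∀ x ∈ Metric.ball τ r, ∃ A ∈ F, ∀ v,
        symQuad A v + v ⬝ᵥ v = C * secondDeriv ψ x (WithLp.toLp 2 v) := by
  obtain ⟨U, ρ, hρ, B, hB, hBρ⟩ := hΩF τ hτ
  obtain ⟨δ, hδ, C₀, hC₀, hC⟩ := exists_forall_mem_of_mem_interior_raySet hF hB
  have hρ0 := hρ.eq_zero hΩ hτ
  have hat : ∀ g : EuclideanSpace ℝ (Fin n) → ℝ, ContDiffOn ℝ ∞ g U → ∀ x ∈ U,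
      ContDiffAt ℝ 2 g x := fun g hg x hx =>
    (hg.contDiffAt (hρ.isOpen.mem_nhds hx)).of_le (by norm_cast)
  obtain ⟨c, hc0, hc⟩ := LinearMap.exists_neg_mul_norm_sq_le
    (LinearMap.mk₂ ℝ (fun v w : EuclideanSpace ℝ (Fin n) =>
      fderiv ℝ (fderiv ℝ ρ) τ v w - v.ofLp ⬝ᵥ ((B : Matrix (Fin n) (Fin n) ℝ).mulVec w.ofLp))
      (fun v v' w => by simp [add_dotProduct]; ring)
      (fun a v w => by simp [smul_dotProduct]; ring)
      (fun v w w' => by simp [Matrix.mulVec_add, dotProduct_add]; ring)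
      (fun a v w => by simp [Matrix.mulVec_smul, dotProduct_smul]; ring))
    (fderiv ℝ ρ τ : EuclideanSpace ℝ (Fin n) →ₗ[ℝ] ℝ)
    (fun h => hρ.grad_ne τ hρ.mem (ContinuousLinearMap.coe_injective h))
    (fun v w hv hw => by
      simpa [sub_eq_zero] using hBρ v w hv hw) (δ := δ / 4) (by positivity)
  set σ : EuclideanSpace ℝ (Fin n) → ℝ := fun x => ρ x + c / 2 * ρ x ^ 2 with hσ
  have hσU : ContDiffOn ℝ ∞ σ U := hρ.smooth.add (contDiffOn_const.mul (hρ.smooth.pow 2))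
  have hN : ContDiff ℝ ∞ fun x => ‖x - τ‖ ^ 2 := (contDiff_id.sub contDiff_const).norm_sq ℝ
  set ψ : EuclideanSpace ℝ (Fin n) → ℝ := fun x => σ x + (-(δ / 8)) * ‖x - τ‖ ^ 2 with hψ
  have hψU : ContDiffOn ℝ ∞ ψ U := hσU.add (contDiffOn_const.mul hN.contDiffOn)
  -- Of the total loss `δ`, a quarter comes from the comparison with `B`, a quarter from the
  -- quadratic term, and a half from moving off `τ`.
  have hψτ : ∀ v, symQuad B v.ofLp - δ / 2 * ‖v‖ ^ 2 ≤ secondDeriv ψ τ v := by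
    intro v
    have h1 := hc v
    simp only [LinearMap.mk₂_apply, ContinuousLinearMap.coe_coe] at h1
    rw [hψ, secondDeriv_add_const_mul (hat σ hσU τ hρ.mem) (hN.contDiffAt.of_le (by norm_cast)),
      secondDeriv_norm_sub_sq, hσ, (hat ρ hρ.smooth τ hρ.mem).secondDeriv_add_mul_sq hρ0]
    simp only [symQuad, secondDeriv]
    linarith
  -- Where `ρ ≤ 0`, this gives `ρ (1 + (c/2) ρ) ≤ 0`, so squaring does not spoil the sign.
  have hbig : ∀ᶠ x in 𝓝 τ, -1 ≤ c / 2 * ρ x := by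
    have h1 : ContinuousAt (fun x => c / 2 * ρ x) τ :=
      continuousAt_const.mul (hρ.smooth.continuousOn.continuousAt (hρ.isOpen.mem_nhds hρ.mem))
    exact (h1.eventually_const_lt (u := -1) (by simp [hρ0])).mono fun _ h => h.le
  obtain ⟨r, hr, hball⟩ := Metric.eventually_nhds_iff_ball.1
    (((eventually_secondDeriv_ge hρ.isOpen hρ.mem hψU (half_pos hδ)).and hbig).and
      (hρ.isOpen.mem_nhds hρ.mem))
  refine ⟨r, hr, δ / 8, by positivity, ψ, hψU.mono fun x hx => (hball x hx).2,
    by simp [hψ, hσ, hρ0], fun x hx hxr => ?_, C₀, hC₀, fun C hCC x hx => ?_⟩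
  · obtain ⟨⟨-, h1⟩, hxU⟩ := hball x hxr
    have h2 := hρ.nonpos hx hxU
    simp only [hψ, hσ]
    nlinarith
  · obtain ⟨⟨h1, -⟩, hxU⟩ := hball x hx
    obtain ⟨A, hA⟩ := exists_coe_eq_hessMatrix (stdBasis n) (hat ψ hψU x hxU)
    have hq : ∀ v, symQuad (C • A - symOne (Fin n)) v + v ⬝ᵥ v
        = C * secondDeriv ψ x (WithLp.toLp 2 v) := fun v => by
      rw [symQuad_sub, symQuad_smul, symQuad_symOne, symQuad_eq_secondDeriv_std hA]
      ring
    refine ⟨C • A - symOne (Fin n), hC C hCC _ fun v => ?_, hq⟩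
    have h2 := h1 (WithLp.toLp 2 v)
    have h3 := hψτ (WithLp.toLp 2 v)
    rw [dotProduct_self_eq_norm_sq] at *
    have h4 := hq v
    rw [dotProduct_self_eq_norm_sq] at h4
    have h5 : symQuad B v - δ * ‖WithLp.toLp 2 v‖ ^ 2
        ≤ secondDeriv ψ x (WithLp.toLp 2 v) := by
      simp only at h3
      linarith
    have h6 := mul_le_mul_of_nonneg_left h5 (hC₀.le.trans hCC)
    linarith

end Barrier

/-! ### Upper bounds for the competitors -/

section UpperBounds

variable {n m : ℕ} {F : Set (SymMat (Fin n))} {Ω : Set (EuclideanSpace ℝ (Fin n))}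
  {φ : EuclideanSpace ℝ (Fin n) × EuclideanSpace ℝ (Fin m) → ℝ}

theorem UpperSemicontinuousOn.exists_forall_le_coe {V : Type*} [TopologicalSpace V]
    {f : V → EReal} {K : Set V} (hK : IsCompact K) (hf : UpperSemicontinuousOn f K)
    (htop : ∀ z ∈ K, f z ≠ ⊤) : ∃ M : ℝ, ∀ z ∈ K, f z ≤ (M : EReal) := by
  rcases K.eq_empty_or_nonempty with rfl | hne
  · exact ⟨0, by simp⟩
  · obtain ⟨z₁, hz₁, hmax⟩ := hf.exists_isMaxOn hne hK
    exact ⟨(f z₁).toReal, fun z hz => (hmax hz).trans (EReal.le_coe_toReal (htop z₁ hz₁))⟩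

/-- The added term `k‖y' - y‖²` lifts the comparison function above `ζ` on the lateral sides of the
cylinder. The constant `k` depends on `ζ`, but the term vanishes on the slice itself, so the
conclusion is uniform in `ζ`. -/
theorem IsPerronCompetitor.le_of_slice
    {ζ : EuclideanSpace ℝ (Fin n) × EuclideanSpace ℝ (Fin m) → EReal}
    (hζ : IsPerronCompetitor F Ω φ ζ) {K D : Set (EuclideanSpace ℝ (Fin n))} (hK : IsCompact K)
    (hKΩ : K ⊆ closure Ω) (hD : IsOpen D) (hDK : D ⊆ K) (hDΩ : D ⊆ Ω)
    {w : EuclideanSpace ℝ (Fin n) → ℝ} (hwK : ContinuousOn w K) (hw : ContDiffOn ℝ ∞ w D)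
    (hwF : ∀ x ∈ D, ∀ A ∈ F, ¬∀ v, symQuad A v = secondDeriv w x (WithLp.toLp 2 v))
    {y : EuclideanSpace ℝ (Fin m)} {δ : ℝ} (hδ : 0 < δ)
    (hbd : ∀ x ∈ K \ D, ∀ y' ∈ Metric.closedBall y δ, ζ (x, y') ≤ (w x : EReal)) :
    ∀ x ∈ K, ζ (x, y) ≤ (w x : EReal) := by
  have hKK : IsCompact (K ×ˢ Metric.closedBall y δ) := hK.prod (isCompact_closedBall y δ)
  have hsub : K ×ˢ Metric.closedBall y δ ⊆ closure Ω ×ˢ univ := prod_mono hKΩ (subset_univ _)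
  obtain ⟨M, hM⟩ := (hζ.usc.mono hsub).exists_forall_le_coe hKK fun z hz => hζ.ne_top z (hsub hz)
  obtain ⟨N, hN⟩ := hK.bddBelow_image hwK
  have hN : ∀ x ∈ K, N ≤ w x := fun x hx => hN ⟨x, hx, rfl⟩
  set k : ℝ := max 0 ((M - N) / δ ^ 2) with hk
  have hk0 : 0 ≤ k := le_max_left _ _
  have hkδ : M - N ≤ k * δ ^ 2 := by
    rw [← div_le_iff₀ (by positivity)]; exact le_max_right _ _
  set p : EuclideanSpace ℝ (Fin n) × EuclideanSpace ℝ (Fin m) → ℝ :=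
    fun z => w z.1 + k * ‖z.2 - y‖ ^ 2 with hp
  have hq : ContDiff ℝ ∞ fun z : EuclideanSpace ℝ (Fin n) × EuclideanSpace ℝ (Fin m) =>
      k * ‖z.2 - y‖ ^ 2 :=
    contDiff_const.mul ((contDiff_snd.sub contDiff_const).norm_sq ℝ)
  have hpW : ContDiffOn ℝ ∞ p (D ×ˢ Metric.ball y δ) :=
    (hw.comp contDiffOn_fst fun z hz => hz.1).add hq.contDiffOn
  have key := hζ.subharmonic.le_of_hess_notMem hKK (hζ.usc.mono hsub)
    (hD.prod Metric.isOpen_ball) (prod_mono hDK Metric.ball_subset_closedBall)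
    (prod_mono hDΩ (subset_univ _)) (p := p)
    ((hwK.comp continuousOn_fst fun z hz => hz.1).add hq.continuous.continuousOn) hpW ?_ ?_
  · intro x hx
    simpa [hp] using key (x, y) ⟨hx, Metric.mem_closedBall_self hδ.le⟩
  · rintro ⟨x, y'⟩ ⟨hx, hy'⟩ ⟨A, hA, hAe⟩
    -- The pullback by the zero graph sees only directions `(v, 0)`, where the added quadratic is
    -- constant.
    refine hwF x hx _ (hA.2 0) fun v => ?_
    have hpat : ContDiffAt ℝ 2 p (x, y') :=
      (hpW.contDiffAt ((hD.prod Metric.isOpen_ball).mem_nhds ⟨hx, hy'⟩)).of_le (by norm_cast)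
    have hwat : ContDiffAt ℝ 2 w x :=
      (hw.contDiffAt (hD.mem_nhds hx)).of_le (by norm_cast)
    rw [symQuad_graphPullback, Matrix.zero_mulVec, symQuad_eq_secondDeriv_prod hAe]
    refine hpat.secondDeriv_eq ?_ (hwat.hasDerivAt_fderiv_line (WithLp.toLp 2 v))
    filter_upwards [hwat.eventually_hasDerivAt_line (WithLp.toLp 2 v)] with t ht
    simpa [hp] using ht.add_const (k * ‖y' - y‖ ^ 2)
  · rintro ⟨x, y'⟩ ⟨⟨hx, hy'⟩, hnot⟩
    by_cases hxD : x ∈ D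
    · have hy2 : δ ≤ ‖y' - y‖ := by
        by_contra! h
        exact hnot ⟨hxD, by simpa [dist_eq_norm] using h⟩
      refine (hM _ ⟨hx, hy'⟩).trans (EReal.coe_le_coe_iff.2 ?_)
      have h1 : δ ^ 2 ≤ ‖y' - y‖ ^ 2 := pow_le_pow_left₀ hδ.le hy2 2
      have h2 := mul_le_mul_of_nonneg_left h1 hk0
      have h3 := hN x hx
      simp only [hp]
      linarith
    · refine (hbd x ⟨hx, hxD⟩ y' hy').trans (EReal.coe_le_coe_iff.2 ?_)
      simp only [hp]
      have : 0 ≤ k * ‖y' - y‖ ^ 2 := by positivity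
      linarith

/-- Compare slices with a concave paraboloid whose Hessian `-2t I` is too negative for `F`. Slices
centred in the unit ball use cylinders of radius one, hence the ball of radius two for `φ`. -/
theorem exists_competitor_bound (hF : IsDirichletSet F) (hΩ : IsOpen Ω)
    (hΩb : Bornology.IsBounded Ω) (hφ : ContinuousOn φ (frontier Ω ×ˢ univ))
    (y₀ : EuclideanSpace ℝ (Fin m)) :
    ∃ M : ℝ, ∀ ζ, IsPerronCompetitor F Ω φ ζ → ∀ x ∈ closure Ω, ∀ y ∈ Metric.closedBall y₀ 1,
      ζ (x, y) ≤ (M : EReal) := by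
  have hcΩ : IsCompact (closure Ω) := hΩb.isCompact_closure
  have hfr : IsCompact (frontier Ω) := hcΩ.of_isClosed_subset isClosed_frontier
    frontier_subset_closure
  obtain ⟨M, hM⟩ := (hfr.prod (isCompact_closedBall y₀ 2)).bddAbove_image
    (hφ.mono (prod_mono subset_rfl (subset_univ _)))
  have hM : ∀ x ∈ frontier Ω, ∀ y ∈ Metric.closedBall y₀ 2, φ (x, y) ≤ M :=
    fun x hx y hy => hM ⟨(x, y), ⟨hx, hy⟩, rfl⟩
  obtain ⟨R, hR⟩ := (isBounded_iff_forall_norm_le.1 hΩb.closure)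
  obtain ⟨t, ht0, ht⟩ := hF.exists_forall_notMem_of_le
  refine ⟨M + t * R ^ 2, fun ζ hζ x hx y hy => ?_⟩
  have hnsq : ContDiff ℝ ∞ fun x : EuclideanSpace ℝ (Fin n) => ‖x - 0‖ ^ 2 :=
    (contDiff_id.sub contDiff_const).norm_sq ℝ
  have hw : ContDiff ℝ ∞ fun x : EuclideanSpace ℝ (Fin n) =>
      M + t * R ^ 2 + (-t) * ‖x - 0‖ ^ 2 := contDiff_const.add (contDiff_const.mul hnsq)
  have hxR : ∀ x ∈ closure Ω, t * ‖x‖ ^ 2 ≤ t * R ^ 2 := fun x hx =>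
    mul_le_mul_of_nonneg_left (pow_le_pow_left₀ (norm_nonneg _) (hR x hx) 2) ht0
  have key := hζ.le_of_slice hcΩ subset_rfl hΩ subset_closure subset_rfl
    hw.continuous.continuousOn hw.contDiffOn ?_ (y := y) one_pos ?_ x hx
  · refine key.trans (EReal.coe_le_coe_iff.2 ?_)
    have : 0 ≤ t * ‖x - 0‖ ^ 2 := by positivity
    linarith
  · intro x' _ A hA h
    refine ht A (fun v => ?_) hA
    rw [h, secondDeriv_add_const_mul contDiffAt_const (hnsq.contDiffAt.of_le (by norm_cast)),
      secondDeriv_const, secondDeriv_norm_sub_sq, dotProduct_self_eq_norm_sq]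
    have : 0 ≤ t * ‖WithLp.toLp 2 v‖ ^ 2 := by positivity
    linarith
  · rintro x' ⟨hx', hxn⟩ y' hy'
    have hxf : x' ∈ frontier Ω := by rw [hΩ.frontier_eq]; exact ⟨hx', hxn⟩
    refine (hζ.le_bdry (x', y') ⟨hxf, trivial⟩).trans (EReal.coe_le_coe_iff.2 ?_)
    have h1 := hM x' hxf y' (by
      rw [Metric.mem_closedBall] at *
      linarith [dist_triangle y' y y₀])
    have h2 := hxR x' hx'
    rw [sub_zero]
    linarith

/-- The function `φ(τ, y₀) + η/2 - C ψ` dominates all competitors near `τ`: on the boundary by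
continuity of `φ`, and on the inner sphere because `C` beats the uniform bound `M`. -/
theorem eventually_competitor_le (hF : IsDirichletSet F) (hΩ : IsOpen Ω)
    (hΩb : Bornology.IsBounded Ω) (hΩdual : IsStrictlyRayConvex (dirichletDual F) Ω)
    (hφ : ContinuousOn φ (frontier Ω ×ˢ univ)) {τ : EuclideanSpace ℝ (Fin n)}
    (hτ : τ ∈ frontier Ω) (y₀ : EuclideanSpace ℝ (Fin m)) {η : ℝ} (hη : 0 < η) :
    ∀ᶠ z in 𝓝[closure Ω ×ˢ univ] (τ, y₀), ∀ ζ, IsPerronCompetitor F Ω φ ζ →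
      ζ z ≤ ((φ (τ, y₀) + η : ℝ) : EReal) := by
  obtain ⟨M, hM⟩ := exists_competitor_bound hF hΩ hΩb hφ y₀
  obtain ⟨r, hr, ε, hε, ψ, hψ, hψ0, hψle, C₀, hC₀, hC⟩ :=
    exists_local_barrier (dirichletDual_add_mem hF.add_mem) hΩ hΩdual hτ
  have h1 : ∀ᶠ z in 𝓝 (τ, y₀), z ∈ frontier Ω ×ˢ univ → φ z < φ (τ, y₀) + η / 2 :=
    eventually_nhdsWithin_iff.1
      ((hφ (τ, y₀) ⟨hτ, trivial⟩).eventually_lt_const (by linarith))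
  obtain ⟨s, hs, hsφ⟩ := Metric.nhds_basis_closedBall.eventually_iff.1 h1
  have hsφ : ∀ x ∈ frontier Ω, ‖x - τ‖ ≤ s → ∀ y, dist y y₀ ≤ s →
      φ (x, y) < φ (τ, y₀) + η / 2 := fun x hx hxs y hy =>
    hsφ (by
      rw [Metric.mem_closedBall, Prod.dist_eq]
      exact max_le (by rwa [dist_eq_norm]) hy) ⟨hx, trivial⟩
  obtain ⟨r₁, hr₁, hr₁s, hr₁r⟩ : ∃ r₁ > 0, r₁ ≤ s ∧ r₁ < r :=
    ⟨min s (r / 2), by positivity, min_le_left _ _, (min_le_right _ _).trans_lt (half_lt_self hr)⟩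
  obtain ⟨δ, hδ, hδs, hδ1⟩ : ∃ δ > 0, 2 * δ ≤ s ∧ 2 * δ ≤ 1 :=
    ⟨min s 1 / 2, by positivity, by linarith [min_le_left s 1], by linarith [min_le_right s 1]⟩
  obtain ⟨C, hCC, hCM⟩ : ∃ C ≥ C₀, M - φ (τ, y₀) ≤ C * (ε * r₁ ^ 2) := by
    refine ⟨max C₀ ((M - φ (τ, y₀)) / (ε * r₁ ^ 2)), le_max_left _ _, ?_⟩
    rw [← div_le_iff₀ (by positivity)]
    exact le_max_right _ _
  have hC0 : 0 < C := hC₀.trans_le hCC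
  have hballs : Metric.closedBall τ r₁ ⊆ Metric.ball τ r :=
    Metric.closedBall_subset_ball hr₁r
  set w : EuclideanSpace ℝ (Fin n) → ℝ := fun x => φ (τ, y₀) + η / 2 + (-C) * ψ x with hw
  have hwr : ContDiffOn ℝ ∞ w (Metric.ball τ r) :=
    contDiffOn_const.add (contDiffOn_const.mul hψ)
  have key : ∀ ζ, IsPerronCompetitor F Ω φ ζ → ∀ y, dist y y₀ ≤ δ →
      ∀ x ∈ closure Ω ∩ Metric.closedBall τ r₁, ζ (x, y) ≤ (w x : EReal) := by
    intro ζ hζ y hy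
    refine hζ.le_of_slice (D := Ω ∩ Metric.ball τ r₁)
      (hΩb.isCompact_closure.inter_right Metric.isClosed_closedBall)
      inter_subset_left (hΩ.inter Metric.isOpen_ball)
      (inter_subset_inter subset_closure Metric.ball_subset_closedBall) inter_subset_left
      (hwr.continuousOn.mono (inter_subset_right.trans hballs))
      (hwr.mono ((inter_subset_right.trans Metric.ball_subset_closedBall).trans hballs)) ?_ hδ ?_
    · rintro x ⟨-, hx⟩ A hA h
      have hxr : x ∈ Metric.ball τ r := hballs (Metric.ball_subset_closedBall hx)
      obtain ⟨B, hB, hBq⟩ := hC C hCC x hxr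
      -- Were the Hessian `-C D²ψ` in `F`, its translate by the identity would be interior to `F`.
      -- But that translate is `-B` with `B` in the dual.
      refine hB (mem_interior_of_symQuad_add_le hF.add_mem hA one_pos fun v => ?_)
      have hψat : ContDiffAt ℝ 2 ψ x :=
        (hψ.contDiffAt (Metric.isOpen_ball.mem_nhds hxr)).of_le (by norm_cast)
      rw [h, hw, secondDeriv_add_const_mul contDiffAt_const hψat, secondDeriv_const,
        symQuad_neg]
      linarith [hBq v]
    · rintro x ⟨⟨hx, hxr⟩, hnot⟩ y' hy'
      have hψx := hψle x hx (hballs hxr)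
      have hy'0 : dist y' y₀ ≤ 2 * δ := by
        rw [Metric.mem_closedBall] at hy'
        linarith [dist_triangle y' y y₀]
      rw [Metric.mem_closedBall, dist_eq_norm] at hxr
      by_cases hxΩ : x ∈ Ω
      · have hxe : ‖x - τ‖ = r₁ := by
          refine le_antisymm hxr (not_lt.1 fun h => hnot ⟨hxΩ, ?_⟩)
          rwa [Metric.mem_ball, dist_eq_norm]
        refine (hM ζ hζ x hx y' (hy'0.trans hδ1)).trans (EReal.coe_le_coe_iff.2 ?_)
        rw [hxe] at hψx
        have := mul_le_mul_of_nonneg_left hψx hC0.le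
        simp only [hw]
        linarith
      · have hxf : x ∈ frontier Ω := by rw [hΩ.frontier_eq]; exact ⟨hx, hxΩ⟩
        refine (hζ.le_bdry (x, y') ⟨hxf, trivial⟩).trans (EReal.coe_le_coe_iff.2 ?_)
        have h2 := hsφ x hxf (hxr.trans hr₁s) y' (hy'0.trans hδs)
        have h3 : C * ψ x ≤ 0 := mul_nonpos_of_nonneg_of_nonpos hC0.le
          (hψx.trans (by simp only [neg_nonpos]; positivity))
        simp only [hw]
        linarith
  have hwτ : ∀ᶠ x in 𝓝 τ, w x < φ (τ, y₀) + η := by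
    refine (hwr.continuousOn.continuousAt (Metric.ball_mem_nhds τ hr)).eventually_lt_const ?_
    simp only [hw, hψ0]
    linarith
  have hx := (continuous_fst.tendsto (τ, y₀)).eventually
    (hwτ.and (Metric.closedBall_mem_nhds τ hr₁))
  have hy := (continuous_snd.tendsto (τ, y₀)).eventually
    (Metric.closedBall_mem_nhds y₀ hδ)
  filter_upwards [self_mem_nhdsWithin, nhdsWithin_le_nhds hx, nhdsWithin_le_nhds hy]
    with z hz hzx hzy ζ hζ
  exact (key ζ hζ z.2 hzy z.1 ⟨hz.1, hzx.2⟩).trans (EReal.coe_le_coe_iff.2 hzx.1.le)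

end UpperBounds

/-! ### Competitors with prescribed boundary values -/

section LowerBounds

variable {n m : ℕ} {F : Set (SymMat (Fin n))} {Ω : Set (EuclideanSpace ℝ (Fin n))}
  {φ : EuclideanSpace ℝ (Fin n) × EuclideanSpace ℝ (Fin m) → ℝ}

/-- A test function from above and `l(x) + u · y` from below meet at `z₀`, so the Hessian of the
former dominates that of the latter. Being local, the criterion also applies to a maximum of two
such functions. -/
theorem IsTestFunctionAt.exists_mem_starProd
    (hF : ∀ A ∈ F, ∀ P ∈ posCone (Fin n), A + P ∈ F)
    {X : Set (EuclideanSpace ℝ (Fin n) × EuclideanSpace ℝ (Fin m))}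
    {ζ : EuclideanSpace ℝ (Fin n) × EuclideanSpace ℝ (Fin m) → EReal}
    {z₀ : EuclideanSpace ℝ (Fin n) × EuclideanSpace ℝ (Fin m)}
    {g : EuclideanSpace ℝ (Fin n) × EuclideanSpace ℝ (Fin m) → ℝ}
    (hg : IsTestFunctionAt X ζ z₀ g) {l : EuclideanSpace ℝ (Fin n) → ℝ}
    (hl : ContDiffAt ℝ 2 l z₀.1) (u : EuclideanSpace ℝ (Fin m)) {B : SymMat (Fin n)}
    (hB : B ∈ F) (hBl : ∀ v, symQuad B v ≤ secondDeriv l z₀.1 (WithLp.toLp 2 v))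
    (hle : ∀ᶠ z in 𝓝 z₀, ((l z.1 + inner ℝ u z.2 : ℝ) : EReal) ≤ ζ z)
    (heq : ζ z₀ = ((l z₀.1 + inner ℝ u z₀.2 : ℝ) : EReal)) :
    ∃ A ∈ starProd F (posCone (Fin m)),
      (A : Matrix (Fin n ⊕ Fin m) (Fin n ⊕ Fin m) ℝ) = hessMatrix (stdBasisProd n m) g z₀ := by
  obtain ⟨U, hU, hzU, -, hgU, hζg, hg0⟩ := hg
  have hgat : ContDiffAt ℝ 2 g z₀ :=
    (hgU.contDiffAt (hU.mem_nhds hzU)).of_le (by norm_cast)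
  have hpat : ContDiffAt ℝ 2 (fun z : EuclideanSpace ℝ (Fin n) × EuclideanSpace ℝ (Fin m) =>
      l z.1 + inner ℝ u z.2) z₀ :=
    (hl.comp z₀ contDiffAt_fst).add (contDiffAt_const.inner ℝ contDiffAt_snd)
  have hmin : IsLocalMin (fun z => g z - (l z.1 + inner ℝ u z.2)) z₀ := by
    rw [hg0, EReal.coe_eq_coe_iff] at heq
    filter_upwards [hle, hU.mem_nhds hzU] with z h1 h2
    have h3 := EReal.coe_le_coe_iff.1 (h1.trans (hζg z h2))
    linarith
  have hmono : ∀ a b, secondDeriv l z₀.1 a ≤ secondDeriv g z₀ (a, b) := by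
    intro a b
    have h1 : secondDeriv (fun z : EuclideanSpace ℝ (Fin n) × EuclideanSpace ℝ (Fin m) =>
        l z.1 + inner ℝ u z.2) z₀ (a, b) = secondDeriv l z₀.1 a := by
      refine hpat.secondDeriv_eq (k := fun t => fderiv ℝ l (z₀.1 + t • a) a + inner ℝ u b) ?_
        ((hl.hasDerivAt_fderiv_line a).add_const _)
      filter_upwards [hl.eventually_hasDerivAt_line a] with t ht
      have h2 := (innerSL ℝ u).hasFDerivAt.comp_hasDerivAt t (hasDerivAt_add_smul z₀.2 b t)
      exact ht.add h2
    rw [← h1]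
    exact secondDeriv_mono_of_isLocalMin_sub hgat hpat hmin _
  obtain ⟨A, hA⟩ := exists_coe_eq_hessMatrix (stdBasisProd n m) hgat
  refine ⟨A, ⟨mem_posCone_iff.2 fun v => ?_, fun Γ => mem_of_symQuad_le hF hB fun v => ?_⟩, hA⟩
  · rw [symQuad_blockPi, symQuad_eq_secondDeriv_prod hA]
    refine le_trans (le_of_eq ?_) (hmono _ _)
    simp [secondDeriv]
  · rw [symQuad_graphPullback, symQuad_eq_secondDeriv_prod hA]
    exact (hBl v).trans (hmono _ _)

theorem exists_affine_minorant {f : EuclideanSpace ℝ (Fin m) → ℝ} (hf : ConvexOn ℝ univ f)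
    (hfc : Continuous f) (y₀ : EuclideanSpace ℝ (Fin m)) {a : ℝ} (ha : a < f y₀) :
    ∃ (u : EuclideanSpace ℝ (Fin m)) (c : ℝ), (∀ y, inner ℝ u y + c ≤ f y) ∧
      inner ℝ u y₀ + c = a := by
  obtain ⟨l, c, h1, h2⟩ := hf.exists_affine_le_of_lt (𝕜 := ℝ) (mem_univ y₀) ha isClosed_univ
    (hfc.lowerSemicontinuous.lowerSemicontinuousOn _)
  refine ⟨(InnerProductSpace.toDual ℝ _).symm l, c, fun y => ?_, ?_⟩
  · simpa using h1 ⟨y, trivial⟩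
  · simpa using h2

theorem LocallyComparable.exists_bound {T : Set (EuclideanSpace ℝ (Fin n))}
    (hφ : LocallyComparable T φ) {τ₀ : EuclideanSpace ℝ (Fin n)} (hτ₀ : τ₀ ∈ T)
    {u : EuclideanSpace ℝ (Fin m)} (hu : legendre (fun y => φ (τ₀, y)) u < ⊤) :
    ∃ M : ℝ, 0 ≤ M ∧ ∀ τ ∈ T, ∀ y, inner ℝ y u - φ (τ, y) ≤ M := by
  obtain ⟨C, hC⟩ := hφ.bdd u
  refine ⟨|(legendre (fun y => φ (τ₀, y)) u).toReal + C|, abs_nonneg _, fun τ hτ y => ?_⟩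
  refine le_trans ?_ (le_abs_self _)
  have h1 : ((inner ℝ y u - φ (τ, y) : ℝ) : EReal) ≤ legendre (fun y => φ (τ, y)) u :=
    le_iSup (fun y => ((inner ℝ y u - φ (τ, y) : ℝ) : EReal)) y
  have h2 := h1.trans ((hC τ hτ τ₀ hτ₀).trans
    (add_le_add_left (EReal.le_coe_toReal hu.ne) (C : EReal)))
  rw [← EReal.coe_add] at h2
  exact EReal.coe_le_coe_iff.1 h2

theorem EuclideanSpace.norm_le_sum_abs (y : EuclideanSpace ℝ (Fin m)) : ‖y‖ ≤ ∑ i, |y i| := by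
  have h := sum_smul_stdBasis y.ofLp
  rw [WithLp.toLp_ofLp] at h
  calc ‖y‖ = ‖∑ i, y i • stdBasis m i‖ := by rw [h]
    _ ≤ ∑ i, ‖y i • stdBasis m i‖ := norm_sum_le _ _
    _ = ∑ i, |y i| := by simp [norm_smul, stdBasis]

/-- The conjugate at `τ₀` is finite at `u`, hence on a ball by openness. Comparability bounds the
conjugates at `u ± (r/2) eᵢ` uniformly in `τ`, and these finitely many slopes together give linear
growth in `‖y‖`. -/
theorem LocallyComparable.exists_coercive {T : Set (EuclideanSpace ℝ (Fin n))}
    (hφ : LocallyComparable T φ) {τ₀ : EuclideanSpace ℝ (Fin n)} (hτ₀ : τ₀ ∈ T)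
    {u : EuclideanSpace ℝ (Fin m)} {c : ℝ} (hu : ∀ y, inner ℝ u y + c ≤ φ (τ₀, y)) :
    ∃ η > 0, ∃ M : ℝ, ∀ τ ∈ T, ∀ y, inner ℝ u y + η * ‖y‖ - M ≤ φ (τ, y) := by
  have hu0 : legendre (fun y => φ (τ₀, y)) u < ⊤ := by
    refine lt_of_le_of_lt (iSup_le fun y => ?_) (EReal.coe_lt_top (-c))
    rw [EReal.coe_le_coe_iff, real_inner_comm]
    linarith [hu y]
  obtain ⟨r, hr, hball⟩ := Metric.isOpen_iff.1 (hφ.isOpen τ₀ hτ₀) u hu0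
  have hr2 : |r / 2| < r := by rw [abs_of_pos (half_pos hr)]; exact half_lt_self hr
  have hp : ∀ (i : Fin m) (s : ℝ), |s| < r → ∃ M : ℝ, 0 ≤ M ∧ ∀ τ ∈ T, ∀ y,
      inner ℝ u y + s * y i - φ (τ, y) ≤ M := by
    intro i s hs
    obtain ⟨M, hM0, hM⟩ := hφ.exists_bound hτ₀ (u := u + EuclideanSpace.single i s) (hball (by
      simpa [dist_eq_norm] using hs))
    refine ⟨M, hM0, fun τ hτ y => ?_⟩
    have h := hM τ hτ y
    rw [inner_add_right, EuclideanSpace.inner_single_right, real_inner_comm] at h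
    simpa using h
  obtain ⟨M₀, hM₀, hM₀'⟩ := hφ.exists_bound hτ₀ hu0
  choose M₁ hM₁ hM₁' using fun i => hp i (r / 2) hr2
  choose M₂ hM₂ hM₂' using fun i => hp i (-(r / 2)) (by rwa [abs_neg])
  set M : ℝ := M₀ + ∑ i, (M₁ i + M₂ i) with hM
  have hMi : ∀ i, M₁ i ≤ M ∧ M₂ i ≤ M := fun i => by
    have := Finset.single_le_sum (f := fun i => M₁ i + M₂ i)
      (fun i _ => add_nonneg (hM₁ i) (hM₂ i)) (Finset.mem_univ i)
    constructor <;> linarith [hM₁ i, hM₂ i]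
  have hM0 : M₀ ≤ M := le_add_of_nonneg_right
    (Finset.sum_nonneg fun i _ => add_nonneg (hM₁ i) (hM₂ i))
  -- The denominator `m + 1` avoids division by zero when `m = 0`; there `0 ≤ q` rests on the bound
  -- at `u` itself.
  refine ⟨r / 2 / (m + 1), by positivity, M, fun τ hτ y => ?_⟩
  obtain ⟨q, hq⟩ : ∃ q, q = φ (τ, y) - inner ℝ u y + M := ⟨_, rfl⟩
  have hq0 : 0 ≤ q := by
    have := hM₀' τ hτ y
    rw [real_inner_comm] at this
    linarith
  have hqi : ∀ i, r / 2 * |y i| ≤ q := fun i => by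
    have h1 := hM₁' i τ hτ y
    have h2 := hM₂' i τ hτ y
    rcases abs_cases (y i) with ⟨h, -⟩ | ⟨h, -⟩ <;> rw [h] <;> linarith [(hMi i).1, (hMi i).2]
  have h1 : r / 2 * ‖y‖ ≤ (m + 1) * q := by
    calc r / 2 * ‖y‖ ≤ r / 2 * ∑ i, |y i| :=
          mul_le_mul_of_nonneg_left (EuclideanSpace.norm_le_sum_abs y) (half_pos hr).le
      _ = ∑ i, r / 2 * |y i| := Finset.mul_sum _ _ _
      _ ≤ ∑ _i : Fin m, q := Finset.sum_le_sum fun i _ => hqi i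
      _ = m * q := by simp
      _ ≤ (m + 1) * q := by linarith
  have h2 : r / 2 / (m + 1) * ‖y‖ ≤ q := by
    rw [div_mul_eq_mul_div, div_le_iff₀ (by positivity)]
    linarith
  linarith

theorem LocallyComparable.exists_affine_le {T : Set (EuclideanSpace ℝ (Fin n))}
    (hφ : LocallyComparable T φ) (hφc : ContinuousOn φ (T ×ˢ univ))
    {τ₀ : EuclideanSpace ℝ (Fin n)} (hτ₀ : τ₀ ∈ T)
    {u : EuclideanSpace ℝ (Fin m)} {c : ℝ} (hu : ∀ y, inner ℝ u y + c ≤ φ (τ₀, y)) {δ : ℝ}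
    (hδ : 0 < δ) :
    (∃ M : ℝ, ∀ τ ∈ T, ∀ y, inner ℝ u y - M ≤ φ (τ, y)) ∧
      ∃ s > 0, ∀ τ ∈ T, ‖τ - τ₀‖ < s → ∀ y, inner ℝ u y + (c - δ) ≤ φ (τ, y) := by
  obtain ⟨η, hη, M, hM⟩ := hφ.exists_coercive hτ₀ hu
  refine ⟨⟨M, fun τ hτ y => ?_⟩, ?_⟩
  · have : 0 ≤ η * ‖y‖ := by positivity
    linarith [hM τ hτ y]
  -- Outside this radius `η‖y‖ - M > c`, so the coercive bound alone suffices; inside, compactness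
  -- makes continuity in `τ` uniform in `y`.
  have hK := isCompact_closedBall (0 : EuclideanSpace ℝ (Fin m)) ((c + M) / η)
  have h1 : ∀ᶠ τ in 𝓝 τ₀, ∀ y ∈ Metric.closedBall (0 : EuclideanSpace ℝ (Fin m)) ((c + M) / η),
      τ ∈ T → inner ℝ u y + (c - δ) ≤ φ (τ, y) := by
    refine hK.eventually_forall_of_forall_eventually
      (P := fun τ y => τ ∈ T → inner ℝ u y + (c - δ) ≤ φ (τ, y)) fun y _ => ?_
    have h2 : ContinuousWithinAt (fun z : EuclideanSpace ℝ (Fin n) × EuclideanSpace ℝ (Fin m) =>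
        φ z - inner ℝ u z.2) (T ×ˢ univ) (τ₀, y) :=
      (hφc (τ₀, y) ⟨hτ₀, trivial⟩).sub
        (continuous_const.inner continuous_snd).continuousWithinAt
    have h3 := eventually_nhdsWithin_iff.1 (h2.eventually_const_lt (u := c - δ) (by
      simp only
      linarith [hu y]))
    filter_upwards [h3] with z hz hzT
    linarith [hz ⟨hzT, trivial⟩]
  obtain ⟨s, hs, hball⟩ := Metric.eventually_nhds_iff.1 h1
  refine ⟨s, hs, fun τ hτ hτs y => ?_⟩
  by_cases hy : y ∈ Metric.closedBall (0 : EuclideanSpace ℝ (Fin m)) ((c + M) / η)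
  · exact hball (by rwa [dist_eq_norm]) y hy hτ
  · rw [mem_closedBall_zero_iff, not_le, div_lt_iff₀ hη] at hy
    linarith [hM τ hτ y]

/-- The competitor is `h(x) + u · y`. The global quadratic `l₁` lies low enough to respect `φ`
everywhere on the boundary; the local barrier `l₂` is nearly sharp at `τ` and takes over only near
it. Half of `η` is lost in the affine minorant, half in its persistence at nearby boundary points.
-/
theorem exists_competitor_ge (hF : IsDirichletSet F) (hΩ : IsOpen Ω)
    (hΩb : Bornology.IsBounded Ω) (hΩF : IsStrictlyRayConvex F Ω)
    (hφ : ContinuousOn φ (frontier Ω ×ˢ univ))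
    (hφconv : ∀ τ ∈ frontier Ω, ConvexOn ℝ univ fun y => φ (τ, y))
    (hφcomp : LocallyComparable (frontier Ω) φ) {τ : EuclideanSpace ℝ (Fin n)}
    (hτ : τ ∈ frontier Ω) (y₀ : EuclideanSpace ℝ (Fin m)) {η : ℝ} (hη : 0 < η) :
    ∃ ζ, IsPerronCompetitor F Ω φ ζ ∧ ((φ (τ, y₀) - η : ℝ) : EReal) ≤ ζ (τ, y₀) := by
  have hφτ : Continuous fun y => φ (τ, y) :=
    hφ.comp_continuous (Continuous.prodMk_right τ) fun y => ⟨hτ, trivial⟩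
  obtain ⟨u, c, hu, huc⟩ := exists_affine_minorant (hφconv τ hτ) hφτ y₀
    (a := φ (τ, y₀) - η / 2) (by linarith)
  obtain ⟨⟨M, hM⟩, s, hs, hsφ⟩ := hφcomp.exists_affine_le hφ hτ hu (half_pos hη)
  obtain ⟨R, hR⟩ := (isBounded_iff_forall_norm_le.1 hΩb.closure)
  obtain ⟨t, ht0, ht⟩ := hF.exists_forall_mem_of_le
  obtain ⟨r, hr, ε, hε, ψ, hψ, hψ0, hψle, C₀, hC₀, hC⟩ :=
    exists_local_barrier hF.add_mem hΩ hΩF hτ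
  obtain ⟨r₁, hr₁, hr₁s, hr₁r⟩ : ∃ r₁ > 0, r₁ ≤ s ∧ r₁ ≤ r :=
    ⟨min s r, by positivity, min_le_left _ _, min_le_right _ _⟩
  -- This `C` forces `l₂ ≤ l₁` on the outer half of the ball, so that the glued function is
  -- continuous on `closure Ω`.
  obtain ⟨C, hCC, hCM⟩ : ∃ C ≥ C₀, c - η / 2 + M + t * R ^ 2 ≤ C * (ε * (r₁ / 2) ^ 2) := by
    refine ⟨max C₀ ((c - η / 2 + M + t * R ^ 2) / (ε * (r₁ / 2) ^ 2)), le_max_left _ _, ?_⟩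
    rw [← div_le_iff₀ (by positivity)]
    exact le_max_right _ _
  have hC0 : 0 < C := hC₀.trans_le hCC
  have hnsq : ContDiff ℝ ∞ fun x : EuclideanSpace ℝ (Fin n) => ‖x - 0‖ ^ 2 :=
    (contDiff_id.sub contDiff_const).norm_sq ℝ
  set l₁ : EuclideanSpace ℝ (Fin n) → ℝ := fun x => -M - t * R ^ 2 + t * ‖x - 0‖ ^ 2 with hl₁
  set l₂ : EuclideanSpace ℝ (Fin n) → ℝ := fun x => c - η / 2 + C * ψ x with hl₂
  have hl₁c : ContDiff ℝ ∞ l₁ := contDiff_const.add (contDiff_const.mul hnsq)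
  have hl₂c : ContDiffOn ℝ ∞ l₂ (Metric.ball τ r) :=
    contDiffOn_const.add (contDiffOn_const.mul hψ)
  have hl₁M : ∀ x ∈ closure Ω, l₁ x ≤ -M := fun x hx => by
    have := mul_le_mul_of_nonneg_left (pow_le_pow_left₀ (norm_nonneg _) (hR x hx) 2) ht0
    simp only [hl₁, sub_zero]
    linarith
  have hballr : Metric.ball τ r₁ ⊆ Metric.ball τ r := Metric.ball_subset_ball hr₁r
  have hl₂le : ∀ x ∈ closure Ω, x ∈ Metric.ball τ r₁ → l₂ x ≤ c - η / 2 := fun x hx hxr => by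
    have h1 : C * ψ x ≤ 0 := mul_nonpos_of_nonneg_of_nonpos hC0.le
      ((hψle x hx (hballr hxr)).trans (by simp only [neg_nonpos]; positivity))
    simp only [hl₂]
    linarith
  have hl₂l₁ : ∀ x ∈ closure Ω, x ∈ Metric.ball τ r₁ → r₁ / 2 ≤ ‖x - τ‖ → l₂ x ≤ l₁ x := by
    intro x hx hxr hx2
    have h1 := hψle x hx (hballr hxr)
    have h2 : (r₁ / 2) ^ 2 ≤ ‖x - τ‖ ^ 2 := pow_le_pow_left₀ (by positivity) hx2 2
    have h3 : ψ x ≤ -(ε * (r₁ / 2) ^ 2) := h1.trans (neg_le_neg (mul_le_mul_of_nonneg_left h2 hε.le))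
    have h4 := mul_le_mul_of_nonneg_left h3 hC0.le
    have h5 : 0 ≤ t * ‖x - 0‖ ^ 2 := by positivity
    simp only [hl₁, hl₂]
    linarith
  classical
  set h : EuclideanSpace ℝ (Fin n) → ℝ := fun x =>
    if x ∈ Metric.ball τ r₁ then max (l₁ x) (l₂ x) else l₁ x with hh
  have hh₁ : ∀ x, l₁ x ≤ h x := fun x => by
    simp only [hh]; split_ifs
    · exact le_max_left _ _
    · exact le_rfl
  have hh₂ : ∀ x ∈ Metric.ball τ r₁, l₂ x ≤ h x := fun x hx => by
    simp only [hh, if_pos hx]; exact le_max_right _ _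
  have hcont : ContinuousOn h (closure Ω) := by
    intro x hx
    by_cases hxr : x ∈ Metric.ball τ r₁
    · have h1 : h =ᶠ[𝓝 x] fun x => max (l₁ x) (l₂ x) := by
        filter_upwards [Metric.isOpen_ball.mem_nhds hxr] with x' hx' using if_pos hx'
      have h2 : ContinuousAt l₂ x :=
        hl₂c.continuousOn.continuousAt (Metric.isOpen_ball.mem_nhds (hballr hxr))
      exact (ContinuousAt.congr (hl₁c.continuous.continuousAt.max h2) h1.symm).continuousWithinAt
    · have h1 : ∀ᶠ x' in 𝓝[closure Ω] x, h x' = l₁ x' := by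
        have h2 : ∀ᶠ x' in 𝓝 x, r₁ / 2 < ‖x' - τ‖ := by
          have hc : Continuous fun x' : EuclideanSpace ℝ (Fin n) => ‖x' - τ‖ := by fun_prop
          refine (hc.tendsto x).eventually_const_lt ?_
          rw [Metric.mem_ball, dist_eq_norm, not_lt] at hxr
          linarith
        filter_upwards [self_mem_nhdsWithin, nhdsWithin_le_nhds h2] with x' hx' hx2
        simp only [hh]
        split_ifs with hx3
        · exact max_eq_left (hl₂l₁ x' hx' hx3 hx2.le)
        · rfl
      exact hl₁c.continuous.continuousWithinAt.congr_of_eventuallyEq h1 (if_neg hxr)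
  refine ⟨fun z => ((h z.1 + inner ℝ u z.2 : ℝ) : EReal), ⟨?_, fun _ _ => EReal.coe_ne_top _, ?_, ?_⟩,
    ?_⟩
  · refine (continuous_coe_real_ereal.comp_continuousOn ?_).upperSemicontinuousOn
    exact (hcont.comp continuousOn_fst fun z hz => hz.1).add
      (continuous_const.inner continuous_snd).continuousOn
  · refine ⟨?_, fun _ _ => EReal.coe_ne_top _, fun z₀ hz₀ g hg => ?_⟩
    · refine (continuous_coe_real_ereal.comp_continuousOn ?_).upperSemicontinuousOn
      exact (hcont.comp continuousOn_fst fun z hz => subset_closure hz.1).add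
        (continuous_const.inner continuous_snd).continuousOn
    by_cases heq : h z₀.1 = l₁ z₀.1
    · refine hg.exists_mem_starProd hF.add_mem (l := l₁) (hl₁c.contDiffAt.of_le (by norm_cast)) u
        (B := t • symOne (Fin n)) (ht _ fun v => ?_) (fun v => ?_)
        (Eventually.of_forall fun z => ?_) (by rw [heq])
      · rw [symQuad_smul, symQuad_symOne]
      · rw [hl₁, secondDeriv_add_const_mul contDiffAt_const
          (hnsq.contDiffAt.of_le (by norm_cast)), secondDeriv_const, secondDeriv_norm_sub_sq,
          symQuad_smul, symQuad_symOne, dotProduct_self_eq_norm_sq]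
        have : 0 ≤ t * ‖WithLp.toLp 2 v‖ ^ 2 := by positivity
        linarith
      · exact EReal.coe_le_coe_iff.2 (by linarith [hh₁ z.1])
    · have hxr : z₀.1 ∈ Metric.ball τ r₁ := by
        by_contra hxr
        exact heq (if_neg hxr)
      have heq₂ : h z₀.1 = l₂ z₀.1 := by
        simp only [hh, if_pos hxr] at heq ⊢
        exact (max_choice _ _).resolve_left heq
      have hψat : ContDiffAt ℝ 2 ψ z₀.1 :=
        (hψ.contDiffAt (Metric.isOpen_ball.mem_nhds (hballr hxr))).of_le (by norm_cast)
      obtain ⟨B, hB, hBq⟩ := hC C hCC z₀.1 (hballr hxr)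
      refine hg.exists_mem_starProd hF.add_mem (l := l₂)
        (contDiffAt_const.add (contDiffAt_const.mul hψat)) u hB (fun v => ?_) ?_ (by rw [heq₂])
      · rw [hl₂, secondDeriv_add_const_mul contDiffAt_const hψat, secondDeriv_const]
        linarith [hBq v, dotProduct_self_nonneg' v]
      · filter_upwards [continuous_fst.continuousAt.preimage_mem_nhds
          (Metric.isOpen_ball.mem_nhds hxr)] with z hz
        exact EReal.coe_le_coe_iff.2 (by linarith [hh₂ z.1 hz])
  · rintro ⟨x, y⟩ ⟨hx, -⟩
    have hxc := frontier_subset_closure hx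
    refine EReal.coe_le_coe_iff.2 ?_
    simp only [hh]
    have h1 := hM x hx y
    have h2 := hl₁M x hxc
    split_ifs with hxr
    · have h3 := hsφ x hx ((mem_ball_iff_norm.1 hxr).trans_le hr₁s) y
      rcases max_choice (l₁ x) (l₂ x) with h4 | h4 <;> rw [h4]
      · linarith
      · linarith [hl₂le x hxc hxr]
    · linarith
  · refine EReal.coe_le_coe_iff.2 ?_
    have h1 := hh₂ τ (Metric.mem_ball_self hr₁)
    simp only [hl₂, hψ0] at h1
    simp only
    linarith

end LowerBounds

theorem mainTheorem11 (n m : ℕ)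
    (F : Set (SymMat (Fin n))) (hF : IsDirichletSet F) (hFconv : Convex ℝ F)
    (Ω : Set (EuclideanSpace ℝ (Fin n))) (hΩ : IsSmoothlyBounded Ω)
    (hΩF : IsStrictlyRayConvex F Ω) (hΩdual : IsStrictlyRayConvex (dirichletDual F) Ω)
    (φ : EuclideanSpace ℝ (Fin n) × EuclideanSpace ℝ (Fin m) → ℝ)
    (hφcont : ContinuousOn φ (frontier Ω ×ˢ univ))
    (hφconv : ∀ τ ∈ frontier Ω, ConvexOn ℝ univ fun y => φ (τ, y))
    (hφcomp : LocallyComparable (frontier Ω) φ) :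
    IsFSubharmonicOn (stdBasisProd n m) (starProd F (posCone (Fin m))) (Ω ×ˢ univ)
        (perronEnvelope F Ω φ) ∧
      ∀ τ ∈ frontier Ω, ∀ y : EuclideanSpace ℝ (Fin m),
        perronEnvelope F Ω φ (τ, y) = (φ (τ, y) : EReal) := by
  have hop := hΩ.isOpen
  set Φ := perronEnvelope F Ω φ with hΦ
  set S : Set (EuclideanSpace ℝ (Fin n) × EuclideanSpace ℝ (Fin m)) := closure Ω ×ˢ univ with hS
  have hΩS : Ω ×ˢ univ ⊆ S := prod_mono subset_closure subset_rfl
  have hle : ∀ ζ, IsPerronCompetitor F Ω φ ζ → ζ ≤ Φ := fun ζ hζ z =>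
    le_iSup₂ (f := fun ζ (_ : IsPerronCompetitor F Ω φ ζ) => ζ z) ζ hζ
  have hge : ∀ z c, (∀ ζ, IsPerronCompetitor F Ω φ ζ → ζ z ≤ c) → Φ z ≤ c := fun z c h =>
    iSup₂_le h
  have hLUB : IsLUB {ζ | IsPerronCompetitor F Ω φ ζ} Φ :=
    ⟨hle, fun ξ hξ z => hge z _ fun ζ hζ => hξ hζ z⟩
  have htop : ∀ z ∈ S, uscReg S Φ z ≠ ⊤ := by
    rintro ⟨x, y⟩ -
    obtain ⟨M, hM⟩ := exists_competitor_bound hF hop hΩ.isBounded hφcont y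
    refine ne_top_of_le_ne_top (EReal.coe_ne_top M) (uscReg_le ?_)
    filter_upwards [self_mem_nhdsWithin, nhdsWithin_le_nhds
      ((continuous_snd.tendsto (x, y)).eventually (Metric.closedBall_mem_nhds y one_pos))]
      with z hz hzy
    exact hge z _ fun ζ hζ => hM ζ hζ z.1 hz.1 z.2 hzy
  have hsub : IsFSubharmonicOn (stdBasisProd n m) (starProd F (posCone (Fin m))) (Ω ×ˢ univ)
      (uscReg S Φ) := by
    refine isFSubharmonicOn_uscReg (isClosed_starProd hF.isClosed isClosed_posCone) hΩS
      (fun a z => ‖z.1 - a.1‖ ^ 2 + ‖z.2 - a.2‖ ^ 2) (fun a => ?_) (fun a => by simp)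
      (fun a z hz => ?_) (fun ζ hζ => hζ.subharmonic) hLUB fun z hz => htop z (hΩS hz)
    · exact ((contDiff_fst.sub contDiff_const).norm_sq ℝ).add
        ((contDiff_snd.sub contDiff_const).norm_sq ℝ)
    · by_cases h : z.1 = a.1
      · have h2 : z.2 ≠ a.2 := fun h2 => hz (Prod.ext h h2)
        have := norm_pos_iff.2 (sub_ne_zero.2 h2)
        positivity
      · have := norm_pos_iff.2 (sub_ne_zero.2 h)
        positivity
  have hbdry : ∀ z ∈ frontier Ω ×ˢ (univ : Set (EuclideanSpace ℝ (Fin m))),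
      uscReg S Φ z ≤ (φ z : EReal) := by
    rintro ⟨τ, y⟩ ⟨hτ, -⟩
    refine EReal.le_of_forall_lt_iff_le.1 fun c hc => uscReg_le ?_
    rw [EReal.coe_lt_coe_iff] at hc
    filter_upwards [eventually_competitor_le hF hop hΩ.isBounded hΩdual hφcont hτ y
      (sub_pos.2 hc)] with z hz
    simpa using hge z _ hz
  -- Regularizing on the closed set `closure Ω × ℝᵐ`, and not just on the open part, is what makes
  -- the result upper semicontinuous up to the boundary, as a competitor must be.
  have hcomp : IsPerronCompetitor F Ω φ (uscReg S Φ) :=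
    ⟨upperSemicontinuousOn_uscReg S Φ, htop, hsub, hbdry⟩
  have heq : ∀ z ∈ S, uscReg S Φ z = Φ z := fun z hz =>
    le_antisymm (hle _ hcomp z) (le_uscReg hz)
  refine ⟨⟨fun z hz c hc => ?_, fun z hz => ?_, fun z hz g hg => ?_⟩, fun τ hτ y => ?_⟩
  · have hc' : uscReg S Φ z < c := (heq z (hΩS hz)).trans_lt hc
    filter_upwards [hsub.usc z hz c hc', self_mem_nhdsWithin] with z' hz' hz2
    exact (heq z' (hΩS hz2)).symm.trans_lt hz'
  · rw [← heq z (hΩS hz)]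
    exact htop z (hΩS hz)
  · obtain ⟨U, hU, hzU, hUX, hgU, h1, h2⟩ := hg
    exact hsub.hess_mem z hz g ⟨U, hU, hzU, hUX, hgU,
      fun x hx => (heq x (hΩS (hUX hx))).trans_le (h1 x hx), (heq z (hΩS hz)).trans h2⟩
  · refine le_antisymm (hge _ _ fun ζ hζ => hζ.le_bdry _ ⟨hτ, trivial⟩) ?_
    refine EReal.ge_of_forall_gt_iff_ge.1 fun c hc => ?_
    rw [EReal.coe_lt_coe_iff] at hc
    obtain ⟨ζ, hζ, h1⟩ := exists_competitor_ge hF hop hΩ.isBounded hΩF hφcont hφconv hφcomp hτ y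
      (sub_pos.2 hc)
    simpa using h1.trans (hle ζ hζ (τ, y))
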